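/- Let $\phi:\mathbb{R}^d\to[0,\infty)$ be a strictly convex Finsler metric: $\phi(t\xi)=|t|\phi(\xi)$ for $t\in\mathbb{R}$, $\lambda|\xi|\le\phi(\xi)\le\Lambda|\xi|$ for some $0<\lambda\le\Lambda$, the unit ball $\{\phi\le 1\}$ is strictly convex, and $\phi\in C^2(\mathbb{R}^d\setminus\{0\})$. Assume that its dual $\phi^o(\eta)=\sup\{\eta\cdot\xi:\ \phi(\xi)\le 1\}$ is $C^\infty$ on $\mathbb{R}^d\setminus\{0\}$. For $t>0$ let $$K_{\phi,t}=\mathcal{F}^{-1}\big[\xi\mapsto e^{-4\pi^2t\,\phi^o(\xi)^2}\big],\qquad \mathcal F^{-1}[g](x)=\int_{\mathbb{R}^d}g(\xi)\,e^{2\pi i x\cdot\xi}\,d\xi,\qquad K_\phi=K_{\phi,1}.$$ Fix $c\in\mathbb{R}$. For $h>0$ put $\theta_h=\tfrac12-c\sqrt h$, $S_hg=K_{\phi,h}*g$, and $$G_h^+\varphi(x)=\sup\{s\in\mathbb{R}:\ S_h\mathbf 1_{\{\varphi\ge s\}}(x)\ge\theta_h\},\qquad G_h^-\varphi(x)=\inf\{s\in\mathbb{R}:\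 S_h\mathbf 1_{\{\varphi\ge s\}}(x)<\theta_h\}$$ (supremum and infimum in $[-\infty,+\infty]$). For $X\in\mathbb{R}^{d\times d}$ and $p\in\mathbb{R}^d\setminus\{0\}$ put $$F(X,p)=-\Big(\int_{p^\perp}K_\phi\,d\mathcal H^{d-1}\Big)^{-1}\Big(\tfrac12\int_{p^\perp}\langle Xx,x\rangle K_\phi(x)\,d\mathcal H^{d-1}(x)+c|p|\Big).$$ Let $\varphi\in C^2(\mathbb{R}^d)$, let $z\in\mathbb{R}^d$ with $\nabla\varphi(z)\ne0$, and let $\varepsilon>0$. Then there is $\delta>0$ such that for all $x\in B(z,\delta)$ and all $h\in(0,\delta]$, $$G_h^-\varphi(x)\le\varphi(x)+\big(-F(D^2\varphi(z),D\varphi(z))+\varepsilon\big)h\quad\text{and}\quad G_h^+\varphi(x)\ge\varphi(x)+\big(-F(D^2\varphi(z),D\varphi(z))-\varepsilon\big)h.$$ (The case $c=0$ is the unforced anisotropic mean curvature flow; $c\neq0$ models a forcing term.) -/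

import Mathlib

open MeasureTheory FourierTransform Gradient
open scoped ContDiff

noncomputable section

namespace AnisoBMO

/-- A strictly convex, symmetric Finsler metric on `ℝ^d`. As `φ` is linear along rays, its strict
convexity is the strict convexity of its unit ball. -/
structure IsFinslerMetric {d : ℕ} (φ : EuclideanSpace ℝ (Fin d) → ℝ) : Prop where
  homogeneous : ∀ (t : ℝ) (ξ : EuclideanSpace ℝ (Fin d)), φ (t • ξ) = |t| * φ ξ
  bounds : ∃ a b : ℝ, 0 < a ∧ a ≤ b ∧
    ∀ ξ : EuclideanSpace ℝ (Fin d), a * ‖ξ‖ ≤ φ ξ ∧ φ ξ ≤ b * ‖ξ‖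
  strictConvex : StrictConvex ℝ {ξ : EuclideanSpace ℝ (Fin d) | φ ξ ≤ 1}
  contDiffOn : ContDiffOn ℝ 2 φ {0}ᶜ

/-- The dual metric `φ°(η) = sup {η · ξ | φ(ξ) ≤ 1}`. -/
def dualMetric {d : ℕ} (φ : EuclideanSpace ℝ (Fin d) → ℝ) (η : EuclideanSpace ℝ (Fin d)) : ℝ :=
  sSup {r : ℝ | ∃ ξ : EuclideanSpace ℝ (Fin d), φ ξ ≤ 1 ∧ r = inner ℝ η ξ}

/-- The anisotropic heat kernel `K_{φ,t} = 𝓕⁻¹ (ξ ↦ exp (-4 π² t φ°(ξ)²))`, with the convention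
`𝓕⁻¹ f (x) = ∫ exp (2 π i x · ξ) f(ξ) dξ`. It is real valued when `φ` is even; hence the real
part. -/
def kernel {d : ℕ} (φ : EuclideanSpace ℝ (Fin d) → ℝ) (t : ℝ) (x : EuclideanSpace ℝ (Fin d)) : ℝ :=
  (𝓕⁻ (fun ξ : EuclideanSpace ℝ (Fin d) =>
    ((Real.exp (-4 * Real.pi ^ 2 * t * dualMetric φ ξ ^ 2) : ℝ) : ℂ)) x).re

/-- `S_h g = K_{φ,h} * g`. -/
def convOp {d : ℕ} (φ : EuclideanSpace ℝ (Fin d) → ℝ) (h : ℝ)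
    (g : EuclideanSpace ℝ (Fin d) → ℝ) (x : EuclideanSpace ℝ (Fin d)) : ℝ :=
  ∫ y : EuclideanSpace ℝ (Fin d), kernel φ h y * g (x - y)

/-- The threshold `θ_h = 1/2 - c √h`, where `c` is the forcing constant. -/
def threshold (c h : ℝ) : ℝ := 1 / 2 - c * √h

/-- The value `S_h 1_{ψ ≥ s}(x)`. -/
def levelValue {d : ℕ} (φ : EuclideanSpace ℝ (Fin d) → ℝ) (h : ℝ)
    (ψ : EuclideanSpace ℝ (Fin d) → ℝ) (s : ℝ) (x : EuclideanSpace ℝ (Fin d)) : ℝ :=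
  convOp φ h (Set.indicator {y | s ≤ ψ y} (fun _ => 1)) x

/-- `G_h^+ ψ(x) = sup {s ∈ ℝ | S_h 1_{ψ ≥ s}(x) ≥ θ_h}`, in the extended reals. -/
def Gplus {d : ℕ} (φ : EuclideanSpace ℝ (Fin d) → ℝ) (c h : ℝ)
    (ψ : EuclideanSpace ℝ (Fin d) → ℝ) (x : EuclideanSpace ℝ (Fin d)) : EReal :=
  sSup {r : EReal | ∃ s : ℝ, r = (s : EReal) ∧ threshold c h ≤ levelValue φ h ψ s x}

/-- `G_h^- ψ(x) = inf {s ∈ ℝ | S_h 1_{ψ ≥ s}(x) < θ_h}`, in the extended reals. -/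
def Gminus {d : ℕ} (φ : EuclideanSpace ℝ (Fin d) → ℝ) (c h : ℝ)
    (ψ : EuclideanSpace ℝ (Fin d) → ℝ) (x : EuclideanSpace ℝ (Fin d)) : EReal :=
  sInf {r : EReal | ∃ s : ℝ, r = (s : EReal) ∧ levelValue φ h ψ s x < threshold c h}

/-- The Hamiltonian, for `p ≠ 0`,
`F(X,p) = - (∫_{p^⊥} K_φ)⁻¹ (1/2 ∫_{p^⊥} ⟨Xx,x⟩ K_φ(x) + c |p|)`, where `K_φ = K_{φ,1}`. The
integrals are taken against the Lebesgue measure of the hyperplane `p^⊥`, which is the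
`(d-1)`-dimensional Hausdorff measure in its usual normalization. -/
def F {d : ℕ} (φ : EuclideanSpace ℝ (Fin d) → ℝ) (c : ℝ)
    (X : EuclideanSpace ℝ (Fin d) →L[ℝ] EuclideanSpace ℝ (Fin d))
    (p : EuclideanSpace ℝ (Fin d)) : ℝ :=
  -((∫ x : ((Submodule.span ℝ {p})ᗮ : Submodule ℝ (EuclideanSpace ℝ (Fin d))),
        kernel φ 1 (x : EuclideanSpace ℝ (Fin d)))⁻¹ *
    ((1 / 2) * (∫ x : ((Submodule.span ℝ {p})ᗮ : Submodule ℝ (EuclideanSpace ℝ (Fin d))),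
        inner ℝ (X (x : EuclideanSpace ℝ (Fin d))) (x : EuclideanSpace ℝ (Fin d)) *
          kernel φ 1 (x : EuclideanSpace ℝ (Fin d))) + c * ‖p‖))

/-- The Hessian `D²ψ(z)`, as the derivative of the gradient. -/
def hessian {d : ℕ} (ψ : EuclideanSpace ℝ (Fin d) → ℝ) (z : EuclideanSpace ℝ (Fin d)) :
    EuclideanSpace ℝ (Fin d) →L[ℝ] EuclideanSpace ℝ (Fin d) :=
  fderiv ℝ (fun y => ∇ ψ y) z

end AnisoBMO

end

/-! Substituting `y ↦ √h y` turns the level value at height `s = ψ x + σ h` into the integral of the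
time-one kernel `K` over `{y | ψ (x - √h y) ≥ s}`. By Taylor expansion this set is, to leading
order, `{⟨∇ψ x, y⟩ ≤ √h (⟨X y, y⟩ / 2 - σ)}` with `X` the Hessian at `z`. The tangent half-space has
mass exactly `1/2`, because `K` is even with integral one. What remains is a layer of thickness of
order `√h` around the tangent hyperplane. With `p = ∇ψ z`, the level value minus `1/2`, divided by
`√h`, therefore tends to `∫_{p^⊥} K(w) (⟨X w, w⟩ / 2 - σ) / |p|` (`tendsto_levelValue`). For `σ = -F
+ e` this limit is `-c - e I` with `I = (∫_{p^⊥} K) / |p|`, while the threshold gives exactly `-c`.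
So `e = ε` lands below the threshold and `e = -ε` above it. The limit is taken jointly in `(x, h)`,
which gives uniformity in `x`.

Two facts about `K` carry the argument; its pointwise sign plays no role. First, `|K y| ≤ C (1 +
|y|)^{-(d+2)}` (`exists_norm_fourierInv_exp_neg_le`), which makes second moments on hyperplanes
finite and provides a dominating function. The symbol `exp(-q)`, with `q` homogeneous of degree two,
is in general not smooth at the origin, so `K` need not be Schwartz; finite differences of the
symbol replace derivatives. Second, `∫_{p^⊥} K > 0`: by the Fourier slice theorem this is the
integral of `exp(-q)` along a line. -/

noncomputable section

namespace AnisoBMO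

/-! ### Derivatives and finite differences of `exp (-q)` for quadratic `q` -/

section Calculus

universe u

variable {E : Type*} [NormedAddCommGroup E] [NormedSpace ℝ E]

/-- The derivatives of order `j` of a function that is homogeneous of degree `k` and smooth off the
origin are of size `‖ξ‖ ^ (k - j)`. -/
theorem exists_norm_iteratedFDerivWithin_le_of_homogeneous [FiniteDimensional ℝ E] {q : E → ℝ}
    {k : ℕ} (hq : ContDiffOn ℝ ∞ q {0}ᶜ)
    (hom : ∀ t : ℝ, 0 < t → ∀ ξ, q (t • ξ) = t ^ k * q ξ) (j : ℕ) :
    ∃ C : ℝ, 0 ≤ C ∧ ∀ ξ, ξ ≠ 0 →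
      ‖iteratedFDerivWithin ℝ j q {0}ᶜ ξ‖ * ‖ξ‖ ^ j ≤ C * ‖ξ‖ ^ k := by
  have hs : UniqueDiffOn ℝ ({0}ᶜ : Set E) := isOpen_compl_singleton.uniqueDiffOn
  have hcont : ContinuousOn (fun ξ => ‖iteratedFDerivWithin ℝ j q {0}ᶜ ξ‖) (Metric.sphere 0 1) :=
    ((hq.continuousOn_iteratedFDerivWithin (m := j) (by exact_mod_cast le_top) hs).norm).mono
      (fun x hx => by
        rintro rfl
        simp at hx)
  obtain ⟨C, hC⟩ := (isCompact_sphere (0 : E) 1).bddAbove_image hcont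
  refine ⟨max C 0, le_max_right _ _, fun ξ hξ => ?_⟩
  have ht : 0 < ‖ξ‖ := norm_pos_iff.2 hξ
  set t := ‖ξ‖ with ht_def
  have hti : t⁻¹ ≠ 0 := inv_ne_zero ht.ne'
  -- This dilation carries `ξ` to the unit sphere, where compactness bounds the derivatives. Since
  -- `q = t ^ k • (q ∘ g)`, each derivative costs one factor `t⁻¹`.
  let g : E ≃L[ℝ] E := ContinuousLinearEquiv.smulLeft (Units.mk0 t⁻¹ hti)
  have hg : ∀ x, g x = t⁻¹ • x := fun x => rfl
  have hpre : (g ⁻¹' ({0}ᶜ : Set E)) = {0}ᶜ := by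
    ext x; simp
  have hqg : Set.EqOn q (fun x => t ^ k • (q ∘ g) x) {0}ᶜ := by
    intro x _
    have := hom t ht (t⁻¹ • x)
    rw [smul_smul, mul_inv_cancel₀ ht.ne', one_smul] at this
    simp only [Function.comp, hg, smul_eq_mul, this]
  have hgξ : g ξ ∈ ({0}ᶜ : Set E) := by simpa using hξ
  have hcd : ContDiffOn ℝ ∞ (q ∘ g) {0}ᶜ := by
    have := hq.comp (s := g ⁻¹' {0}ᶜ) g.contDiff.contDiffOn (fun x hx => hx)
    rwa [hpre] at this
  have h1 : iteratedFDerivWithin ℝ j q {0}ᶜ ξ = t ^ k •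
      (iteratedFDerivWithin ℝ j q {0}ᶜ (g ξ)).compContinuousLinearMap fun _ => (g : E →L[ℝ] E) := by
    rw [iteratedFDerivWithin_congr hqg hξ]
    have := iteratedFDerivWithin_const_smul_apply (a := t ^ k) (i := j)
      ((hcd ξ hξ).of_le (m := j) (by exact_mod_cast le_top)) hs hξ
    rw [← g.iteratedFDerivWithin_comp_right q hs hgξ j, hpre, ← this]
    rfl
  have hgn : ‖(g : E →L[ℝ] E)‖ ≤ t⁻¹ :=
    ContinuousLinearMap.opNorm_le_bound _ (by positivity) (fun x => by
      simp [hg, norm_smul, abs_of_pos ht])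
  have hgs : g ξ ∈ Metric.sphere (0 : E) 1 := by
    simp [hg, norm_smul, abs_of_pos ht, ← ht_def, ht.ne']
  have h2 : ‖iteratedFDerivWithin ℝ j q {0}ᶜ (g ξ)‖ ≤ max C 0 :=
    (hC (Set.mem_image_of_mem _ hgs)).trans (le_max_left _ _)
  have h3 : ‖iteratedFDerivWithin ℝ j q {0}ᶜ ξ‖ ≤ t ^ k * (max C 0 * (t⁻¹) ^ j) := by
    rw [h1, norm_smul, norm_pow, Real.norm_of_nonneg ht.le]
    gcongr
    refine (ContinuousMultilinearMap.norm_compContinuousLinearMap_le _ _).trans ?_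
    simp only [Finset.prod_const, Finset.card_univ, Fintype.card_fin]
    gcongr
  calc _ ≤ t ^ k * (max C 0 * (t⁻¹) ^ j) * t ^ j := by gcongr
    _ = max C 0 * t ^ k := by
      rw [inv_pow]; field_simp

/-- Leibniz rule applied to `D exp(-q) = -exp(-q) Dq`. Every term keeps at least one derivative on
`q`, and that derivative supplies the factor `‖ξ‖ ^ 2`. -/
theorem norm_iteratedFDerivWithin_exp_neg_le {q : E → ℝ} (hq : ContDiffOn ℝ ∞ q {0}ᶜ) (i : ℕ)
    {C : ℝ} {ξ : E} (hξ : ξ ≠ 0)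
    (hC : ∀ j ≤ i + 1, ‖iteratedFDerivWithin ℝ j q {0}ᶜ ξ‖ * ‖ξ‖ ^ j ≤ C * ‖ξ‖ ^ 2) :
    ‖iteratedFDerivWithin ℝ (i + 1) (fun x => Real.exp (-q x)) {0}ᶜ ξ‖ * ‖ξ‖ ^ (i + 1) ≤
      ∑ j ∈ Finset.range (i + 1), (i.choose j : ℝ) * (C * ‖ξ‖ ^ 2) *
        (‖iteratedFDerivWithin ℝ j (fun x => Real.exp (-q x)) {0}ᶜ ξ‖ * ‖ξ‖ ^ j) := by
  have hs : UniqueDiffOn ℝ ({0}ᶜ : Set E) := isOpen_compl_singleton.uniqueDiffOn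
  set f : E → ℝ := fun x => Real.exp (-q x) with hf
  have hfc : ContDiffOn ℝ ∞ f {0}ᶜ := hq.neg.exp
  have hdq : ContDiffOn ℝ ∞ (fun x => -fderivWithin ℝ q {0}ᶜ x) {0}ᶜ :=
    (hq.fderivWithin hs (by simp)).neg
  have hdf : Set.EqOn (fderivWithin ℝ f {0}ᶜ) (fun x => f x • -fderivWithin ℝ q {0}ᶜ x) {0}ᶜ := by
    intro x hx
    have h1 : HasFDerivWithinAt q (fderivWithin ℝ q {0}ᶜ x) {0}ᶜ x :=
      ((hq x hx).differentiableWithinAt (by simp)).hasFDerivWithinAt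
    exact (h1.neg.exp).fderivWithin (hs x hx)
  rw [← norm_iteratedFDerivWithin_fderivWithin hs hξ, iteratedFDerivWithin_congr hdf hξ]
  have h1 := norm_iteratedFDerivWithin_smul_le (n := i) hfc hdq hs hξ (by exact_mod_cast le_top)
  refine (mul_le_mul_of_nonneg_right h1 (by positivity)).trans ?_
  rw [Finset.sum_mul]
  refine Finset.sum_le_sum fun j hj => ?_
  have hji : j ≤ i := Nat.lt_succ_iff.1 (Finset.mem_range.1 hj)
  have h2 : ‖iteratedFDerivWithin ℝ (i - j) (fun x => -fderivWithin ℝ q {0}ᶜ x) {0}ᶜ ξ‖ =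
      ‖iteratedFDerivWithin ℝ (i - j + 1) q {0}ᶜ ξ‖ := by
    rw [← norm_iteratedFDerivWithin_fderivWithin hs hξ]
    have := iteratedFDerivWithin_neg_apply (i := i - j) (f := fderivWithin ℝ q {0}ᶜ) hs hξ
    have h3 : (fun x => -fderivWithin ℝ q {0}ᶜ x) = -fderivWithin ℝ q {0}ᶜ := rfl
    rw [h3, this, norm_neg]
  have h4 := hC (i - j + 1) (by omega)
  rw [h2]
  have h5 : ‖ξ‖ ^ (i + 1) = ‖ξ‖ ^ j * ‖ξ‖ ^ (i - j + 1) := by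
    rw [← pow_add]; congr 1; omega
  rw [h5]
  calc _ = (i.choose j : ℝ) * (‖iteratedFDerivWithin ℝ (i - j + 1) q {0}ᶜ ξ‖ * ‖ξ‖ ^ (i - j + 1)) *
        (‖iteratedFDerivWithin ℝ j f {0}ᶜ ξ‖ * ‖ξ‖ ^ j) := by ring
    _ ≤ _ := by gcongr

/-- Bounds on the derivatives of `exp (-q)`, where `q` is quadratic and smooth off the origin. -/
theorem exists_weighted_bound_iteratedFDerivWithin_exp_neg [FiniteDimensional ℝ E] {q : E → ℝ}
    (hq : ContDiffOn ℝ ∞ q {0}ᶜ) (hom : ∀ t : ℝ, 0 < t → ∀ ξ, q (t • ξ) = t ^ 2 * q ξ)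
    {a : ℝ} (ha : 0 < a) (hqa : ∀ ξ, a * ‖ξ‖ ^ 2 ≤ q ξ) (i : ℕ) :
    ∀ k : ℕ, ∃ C : ℝ, 0 ≤ C ∧ ∀ ξ, ξ ≠ 0 →
      ‖iteratedFDerivWithin ℝ i (fun x => Real.exp (-q x)) {0}ᶜ ξ‖ * ‖ξ‖ ^ i * ‖ξ‖ ^ (2 * k) ≤ C := by
  choose B hB0 hB using exists_norm_iteratedFDerivWithin_le_of_homogeneous hq hom
  induction i using Nat.strong_induction_on with
  | _ i ih =>
    intro k
    rcases i with _ | i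
    · refine ⟨k.factorial / a ^ k, by positivity, fun ξ hξ => ?_⟩
      have h1 : (a * ‖ξ‖ ^ 2) ^ k / k.factorial ≤ Real.exp (q ξ) :=
        (Real.pow_div_factorial_le_exp _ (by positivity) k).trans (Real.exp_le_exp.2 (hqa ξ))
      rw [norm_iteratedFDerivWithin_zero, Real.norm_of_nonneg (Real.exp_pos _).le, pow_zero, mul_one,
        Real.exp_neg, inv_mul_le_iff₀ (Real.exp_pos _)]
      rw [div_le_iff₀ (by positivity)] at h1
      rw [mul_div_assoc', le_div_iff₀ (by positivity)]
      calc _ = (a * ‖ξ‖ ^ 2) ^ k := by ring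
        _ ≤ _ := h1
    -- The recursion produces an extra `‖ξ‖ ^ 2`, absorbed by using the lower-order bounds with
    -- weight `k + 1`; hence the quantification over `k` inside the induction.
    · have hB' : ∀ j : ℕ, ∃ C : ℝ, 0 ≤ C ∧ ∀ ξ, ξ ≠ 0 → j ≤ i →
          ‖iteratedFDerivWithin ℝ j (fun x => Real.exp (-q x)) {0}ᶜ ξ‖ * ‖ξ‖ ^ j *
            ‖ξ‖ ^ (2 * (k + 1)) ≤ C := by
        intro j
        by_cases hj : j ≤ i
        · obtain ⟨C, hC, h⟩ := ih j (by omega) (k + 1)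
          exact ⟨C, hC, fun ξ hξ _ => h ξ hξ⟩
        · exact ⟨0, le_rfl, fun ξ hξ h => absurd h hj⟩
      choose A hA0 hA using hB'
      set C := ∑ j ∈ Finset.range (i + 2), B j with hCdef
      have hC0 : 0 ≤ C := Finset.sum_nonneg fun j _ => hB0 j
      refine ⟨∑ j ∈ Finset.range (i + 1), (i.choose j : ℝ) * C * A j,
        Finset.sum_nonneg fun j _ => by have := hA0 j; positivity, fun ξ hξ => ?_⟩
      have h1 := norm_iteratedFDerivWithin_exp_neg_le hq i (C := C) hξ (fun j hj =>
        (hB j ξ hξ).trans (by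
          gcongr
          exact Finset.single_le_sum (f := B) (fun j _ => hB0 j) (Finset.mem_range.2 (by omega))))
      refine (mul_le_mul_of_nonneg_right h1 (by positivity)).trans ?_
      rw [Finset.sum_mul]
      refine Finset.sum_le_sum fun j hj => ?_
      have h2 := hA j ξ hξ (Nat.lt_succ_iff.1 (Finset.mem_range.1 hj))
      calc _ = (i.choose j : ℝ) * C * (‖iteratedFDerivWithin ℝ j (fun x => Real.exp (-q x)) {0}ᶜ ξ‖ *
            ‖ξ‖ ^ j * ‖ξ‖ ^ (2 * (k + 1))) := by ring
        _ ≤ _ := by gcongr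

/-- The weighted bounds with `k = 0` make the lower-order terms bounded, and one more use of the
Leibniz estimate keeps its factor `‖ξ‖ ^ 2`. Thus derivatives of positive order have the same size
near the origin as those of `q`. -/
theorem exists_norm_iteratedFDerivWithin_exp_neg_le [FiniteDimensional ℝ E] {q : E → ℝ}
    (hq : ContDiffOn ℝ ∞ q {0}ᶜ) (hom : ∀ t : ℝ, 0 < t → ∀ ξ, q (t • ξ) = t ^ 2 * q ξ)
    {a : ℝ} (ha : 0 < a) (hqa : ∀ ξ, a * ‖ξ‖ ^ 2 ≤ q ξ) (i : ℕ) :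
    ∃ C : ℝ, 0 ≤ C ∧ ∀ ξ, ξ ≠ 0 →
      ‖iteratedFDerivWithin ℝ (i + 1) (fun x => Real.exp (-q x)) {0}ᶜ ξ‖ * ‖ξ‖ ^ (i + 1) ≤
        C * ‖ξ‖ ^ 2 := by
  choose B hB0 hB using exists_norm_iteratedFDerivWithin_le_of_homogeneous hq hom
  choose A hA0 hA using fun j => exists_weighted_bound_iteratedFDerivWithin_exp_neg hq hom ha hqa j 0
  set C := ∑ j ∈ Finset.range (i + 2), B j with hCdef
  have hC0 : 0 ≤ C := Finset.sum_nonneg fun j _ => hB0 j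
  refine ⟨∑ j ∈ Finset.range (i + 1), (i.choose j : ℝ) * C * A j,
    Finset.sum_nonneg fun j _ => by have := hA0 j; positivity, fun ξ hξ => ?_⟩
  have h1 := norm_iteratedFDerivWithin_exp_neg_le hq i (C := C) hξ (fun j hj =>
    (hB j ξ hξ).trans (by
      gcongr
      exact Finset.single_le_sum (f := B) (fun j _ => hB0 j) (Finset.mem_range.2 (by omega))))
  refine h1.trans ?_
  clear_value C
  rw [Finset.sum_mul]
  refine Finset.sum_le_sum fun j hj => ?_
  have h2 := hA j ξ hξ
  rw [mul_zero, pow_zero, mul_one] at h2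
  calc _ = (i.choose j : ℝ) * C * (‖iteratedFDerivWithin ℝ j (fun x => Real.exp (-q x)) {0}ᶜ ξ‖ *
        ‖ξ‖ ^ j) * ‖ξ‖ ^ 2 := by ring
    _ ≤ _ := by gcongr

theorem hasFDerivAt_fwdDiff_iter {G : Type*} [NormedAddCommGroup G] [NormedSpace ℝ G] {u : E → G}
    {u' : E → E →L[ℝ] G} (v : E) (m : ℕ) :
    ∀ ξ : E, (∀ k ≤ m, HasFDerivAt u (u' (ξ + k • v)) (ξ + k • v)) →
      HasFDerivAt ((fwdDiff v)^[m] u) ((fwdDiff v)^[m] u' ξ) ξ := by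
  induction m with
  | zero =>
    intro ξ h
    simpa using h 0 le_rfl
  | succ m ih =>
    intro ξ h
    rw [Function.iterate_succ_apply', Function.iterate_succ_apply']
    have h1 := ih ξ fun k hk => h k (by omega)
    have h2 := ih (ξ + v) fun k hk => by
      have := h (k + 1) (by omega)
      rwa [succ_nsmul', ← add_assoc] at this
    exact ((hasFDerivAt_comp_add_right v).2 h2).sub h1

/-- Iterated differences are bounded by iterated derivatives. -/
theorem norm_fwdDiff_iter_le {E : Type u} [NormedAddCommGroup E] [NormedSpace ℝ E] {s : Set E}
    (hs : IsOpen s) (v : E) {C : ℝ} (m : ℕ) :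
    ∀ {G : Type u} [NormedAddCommGroup G] [NormedSpace ℝ G] {u : E → G} (ξ : E),
      ContDiffOn ℝ m u s →
      (∀ r ∈ Set.Icc (0 : ℝ) m, ξ + r • v ∈ s ∧
        ‖iteratedFDerivWithin ℝ m u s (ξ + r • v)‖ ≤ C) →
      ‖(fwdDiff v)^[m] u ξ‖ ≤ C * ‖v‖ ^ m := by
  induction m with
  | zero =>
    intro G _ _ u ξ _ h
    simpa using (h 0 (by simp)).2
  | succ m ih =>
    intro G _ _ u ξ hu h
    have hu' : ContDiffOn ℝ m (fderivWithin ℝ u s) s :=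
      hu.fderivWithin hs.uniqueDiffOn (by push_cast; rfl)
    have hmem : ∀ r ∈ Set.Icc (0 : ℝ) 1, ∀ r' ∈ Set.Icc (0 : ℝ) m,
        r + r' ∈ Set.Icc (0 : ℝ) (m + 1 : ℕ) := by
      intro r hr r' hr'
      push_cast
      exact ⟨by linarith [hr.1, hr'.1], by linarith [hr.2, hr'.2]⟩
    have hder : ∀ r ∈ Set.Icc (0 : ℝ) 1, HasFDerivAt ((fwdDiff v)^[m] u)
        ((fwdDiff v)^[m] (fderivWithin ℝ u s) (ξ + r • v)) (ξ + r • v) := by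
      intro r hr
      refine hasFDerivAt_fwdDiff_iter v m _ fun k hk => ?_
      have h1 := (h (r + k) (hmem r hr k ⟨by positivity, by exact_mod_cast hk⟩)).1
      rw [add_smul, ← add_assoc, Nat.cast_smul_eq_nsmul] at h1
      exact ((hu _ h1).differentiableWithinAt (by simp)).hasFDerivWithinAt.hasFDerivAt
        (hs.mem_nhds h1)
    have hbd : ∀ r ∈ Set.Icc (0 : ℝ) 1,
        ‖(fwdDiff v)^[m] (fderivWithin ℝ u s) (ξ + r • v)‖ ≤ C * ‖v‖ ^ m := by
      intro r hr
      refine ih (ξ + r • v) hu' fun r' hr' => ?_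
      have h1 := h (r + r') (hmem r hr r' hr')
      rw [add_smul, ← add_assoc] at h1
      refine ⟨h1.1, ?_⟩
      rw [norm_iteratedFDerivWithin_fderivWithin hs.uniqueDiffOn h1.1]
      exact h1.2
    have hseg : ∀ x ∈ segment ℝ ξ (ξ + v), ∃ r ∈ Set.Icc (0 : ℝ) 1, x = ξ + r • v := by
      intro x hx
      rw [segment_eq_image'] at hx
      obtain ⟨r, hr, rfl⟩ := hx
      exact ⟨r, hr, by simp⟩
    -- Mean value inequality for the difference of order `m`, whose derivative is the same
    -- difference of the derivative of `u`.
    have := (convex_segment ξ (ξ + v)).norm_image_sub_le_of_norm_hasFDerivWithin_le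
      (f := (fwdDiff v)^[m] u) (f' := (fwdDiff v)^[m] (fderivWithin ℝ u s)) (C := C * ‖v‖ ^ m)
      (fun x hx => by
        obtain ⟨r, hr, rfl⟩ := hseg x hx
        exact (hder r hr).hasFDerivWithinAt)
      (fun x hx => by
        obtain ⟨r, hr, rfl⟩ := hseg x hx
        exact hbd r hr)
      (left_mem_segment ℝ _ _) (right_mem_segment ℝ _ _)
    rw [Function.iterate_succ_apply']
    refine this.trans (le_of_eq ?_)
    rw [add_sub_cancel_left, pow_succ]
    ring

/-- The scaled iterated differences of `exp (-q)`, where `q` is quadratic and smooth off the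
origin. -/
theorem exists_abs_fwdDiff_iter_exp_neg_le {E : Type} [NormedAddCommGroup E] [NormedSpace ℝ E]
    [FiniteDimensional ℝ E] {q : E → ℝ}
    (hq : ContDiffOn ℝ ∞ q {0}ᶜ) (hom : ∀ t : ℝ, 0 < t → ∀ ξ, q (t • ξ) = t ^ 2 * q ξ)
    {a b : ℝ} (ha : 0 < a) (hqa : ∀ ξ, a * ‖ξ‖ ^ 2 ≤ q ξ) (hqb : ∀ ξ, q ξ ≤ b * ‖ξ‖ ^ 2)
    (hb : 0 ≤ b) (m : ℕ) :
    ∃ C : ℝ, 0 ≤ C ∧ ∀ (ρ : ℝ), 0 < ρ → ∀ v : E, ‖v‖ = ρ → ∀ η : E,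
      |(fwdDiff v)^[m + 3] (fun x => Real.exp (-q x)) (ρ • η)| * (1 + ‖η‖) ^ (m + 1) ≤
        C * ρ ^ 2 := by
  obtain ⟨A, hA0, hA⟩ := exists_norm_iteratedFDerivWithin_exp_neg_le hq hom ha hqa (m + 2)
  set M : ℕ := m + 3 with hM
  set C1 : ℝ := 2 ^ M * (b * (3 * M) ^ 2) * (1 + 2 * M) ^ (m + 1) with hC1
  set C2 : ℝ := A * 2 ^ (m + 1) * 2 ^ (m + 1) with hC2
  have hC1' : 0 ≤ C1 := by positivity
  have hC2' : 0 ≤ C2 := by positivity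
  refine ⟨C1 + C2, by positivity, fun ρ hρ v hv η => ?_⟩
  have hM1 : (1 : ℝ) ≤ M := by rw [hM]; push_cast; linarith [Nat.cast_nonneg (α := ℝ) m]
  rcases le_or_gt ‖η‖ (2 * M) with hη | hη
  -- Near the origin the derivatives may blow up, so the difference is estimated term by term.
  -- Subtracting the constant `1`, which differences annihilate, leaves values of size `‖x‖ ^ 2` at
  -- points of norm at most `3 M ρ`.
  · have h1 : (fwdDiff v)^[M] (fun x => Real.exp (-q x)) (ρ • η) =
        (fwdDiff v)^[M] (fun x => Real.exp (-q x) - 1) (ρ • η) := by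
      have : (fun x => Real.exp (-q x)) = (fun x => Real.exp (-q x) - 1) + fun _ => (1 : ℝ) := by
        ext x; simp
      conv_lhs => rw [this, fwdDiff_iter_add]
      have h2 : ∀ n : ℕ, (fwdDiff v)^[n + 1] (fun _ : E => (1 : ℝ)) = 0 := by
        intro n
        induction n with
        | zero => ext x; simp [fwdDiff]
        | succ n ih => rw [Function.iterate_succ_apply', ih]; ext x; simp [fwdDiff]
      simp [hM, h2 (m + 2)]
    have h3 : ∀ x : E, |Real.exp (-q x) - 1| ≤ b * ‖x‖ ^ 2 := by
      intro x
      have hq0 : 0 ≤ q x := le_trans (by positivity) (hqa x)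
      rw [abs_sub_comm, abs_of_nonneg (by linarith [Real.exp_le_one_iff.2 (neg_nonpos.2 hq0)])]
      linarith [Real.add_one_le_exp (-q x), hqb x]
    have h4 : |(fwdDiff v)^[M] (fun x => Real.exp (-q x)) (ρ • η)| ≤
        2 ^ M * (b * (3 * M) ^ 2) * ρ ^ 2 := by
      rw [h1, fwdDiff_iter_eq_sum_shift]
      refine (Finset.abs_sum_le_sum_abs _ _).trans ?_
      have h5 : ∀ k ∈ Finset.range (M + 1), |((-1 : ℤ) ^ (M - k) * (M.choose k : ℤ)) •
          (Real.exp (-q (ρ • η + k • v)) - 1)| ≤ (M.choose k : ℝ) * (b * (3 * M * ρ) ^ 2) := by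
        intro k hk
        have hk' : (k : ℝ) ≤ M := by
          exact_mod_cast Nat.lt_succ_iff.1 (Finset.mem_range.1 hk)
        rw [zsmul_eq_mul, abs_mul]
        push_cast
        rw [abs_mul, abs_pow, abs_neg, abs_one, one_pow, one_mul, Nat.abs_cast]
        gcongr
        refine (h3 _).trans ?_
        gcongr
        calc ‖ρ • η + k • v‖ ≤ ‖ρ • η‖ + ‖k • v‖ := norm_add_le _ _
          _ ≤ ρ * (2 * M) + M * ρ := by
            rw [norm_smul, Real.norm_of_nonneg hρ.le, ← Nat.cast_smul_eq_nsmul ℝ, norm_smul, hv,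
              Real.norm_of_nonneg (Nat.cast_nonneg k)]
            gcongr
          _ = 3 * M * ρ := by ring
      refine (Finset.sum_le_sum h5).trans (le_of_eq ?_)
      rw [← Finset.sum_mul]
      have : ∑ k ∈ Finset.range (M + 1), (M.choose k : ℝ) = 2 ^ M := by
        exact_mod_cast Nat.sum_range_choose M
      rw [this]; ring
    calc _ ≤ 2 ^ M * (b * (3 * M) ^ 2) * ρ ^ 2 * (1 + 2 * M) ^ (m + 1) := by gcongr
      _ = C1 * ρ ^ 2 := by rw [hC1]; ring
      _ ≤ _ := by gcongr; linarith
  · have hη0 : 0 < ‖η‖ := lt_trans (by positivity) hη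
    -- Here the whole path of the difference stays away from the origin. The derivative of order `m
    -- + 3` has size `(ρ ‖η‖) ^ (-(m + 1))`, and the factor `ρ ^ (m + 3)` from the steps leaves `ρ ^
    -- 2`.
    have hlow : ∀ r ∈ Set.Icc (0 : ℝ) M, ρ * ‖η‖ / 2 ≤ ‖ρ • η + r • v‖ := by
      intro r hr
      have h1 := norm_sub_norm_le (ρ • η) (-(r • v))
      rw [sub_neg_eq_add, norm_neg, norm_smul, norm_smul, hv, Real.norm_of_nonneg hρ.le,
        Real.norm_of_nonneg hr.1] at h1
      have h2 : r * ρ ≤ ρ * ‖η‖ / 2 := by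
        have : r ≤ ‖η‖ / 2 := by linarith [hr.2]
        nlinarith
      linarith
    have h1 := norm_fwdDiff_iter_le (s := ({0}ᶜ : Set E)) isOpen_compl_singleton v
      (C := A * (ρ * ‖η‖ / 2)⁻¹ ^ (m + 1)) M (u := fun x => Real.exp (-q x)) (ρ • η)
      ((hq.neg.exp).of_le (m := (M : ℕ)) (by exact_mod_cast le_top)) (fun r hr => by
        have h2 := hlow r hr
        have h3 : 0 < ρ * ‖η‖ / 2 := by positivity
        have h4 : 0 < ‖ρ • η + r • v‖ := h3.trans_le h2
        have h5 : ρ • η + r • v ≠ 0 := norm_pos_iff.1 h4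
        refine ⟨h5, ?_⟩
        have h6 := hA _ h5
        have h7 : ‖ρ • η + r • v‖ ^ (m + 2 + 1) =
          ‖ρ • η + r • v‖ ^ (m + 1) * ‖ρ • η + r • v‖ ^ 2 := by rw [← pow_add]
        rw [h7, ← mul_assoc] at h6
        have h8 := le_of_mul_le_mul_right h6 (by positivity)
        rw [← le_div_iff₀ (by positivity)] at h8
        refine h8.trans ?_
        rw [inv_pow, ← div_eq_mul_inv]
        gcongr)
    rw [hv] at h1
    rw [Real.norm_eq_abs] at h1
    calc _ ≤ A * (ρ * ‖η‖ / 2)⁻¹ ^ (m + 1) * ρ ^ M * (2 * ‖η‖) ^ (m + 1) := by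
          gcongr
          linarith
      _ = C2 * ρ ^ 2 := by
        rw [hC2, hM, inv_pow, div_pow, mul_pow, mul_pow]
        field_simp
        ring
      _ ≤ _ := by gcongr; linarith

end Calculus

/-! ### Decay of the inverse Fourier transform; integration over hyperplanes -/

section Fourier

variable {E : Type} [NormedAddCommGroup E] [InnerProductSpace ℝ E] [FiniteDimensional ℝ E]
  [MeasurableSpace E] [BorelSpace E]

theorem integrable_fwdDiff {g : E → ℂ} (hg : Integrable g) (v : E) :
    Integrable (fwdDiff v g) :=
  (hg.comp_add_right v).sub hg

theorem integrable_fwdDiff_iter {g : E → ℂ} (hg : Integrable g) (v : E) (m : ℕ) :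
    Integrable ((fwdDiff v)^[m] g) := by
  induction m with
  | zero => exact hg
  | succ m ih => rw [Function.iterate_succ_apply']; exact integrable_fwdDiff ih v

theorem fourierInv_fwdDiff {g : E → ℂ} (hg : Integrable g) (v y : E) :
    𝓕⁻ (fwdDiff v g) y = ((Real.fourierChar (-inner ℝ v y) : ℂ) - 1) * 𝓕⁻ g y := by
  have hL : Continuous fun p : E × E => (-innerₗ E) p.1 p.2 := by
    simp only [LinearMap.neg_apply, innerₗ_apply_apply]
    fun_prop
  have h1 := VectorFourier.fourierIntegral_add (μ := (volume : Measure E)) Real.continuous_fourierChar hL hg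
    (integrable_fwdDiff hg v)
  have h2 := VectorFourier.fourierIntegral_comp_add_right Real.fourierChar (volume : Measure E)
    (-innerₗ E) g v
  have h3 : (g ∘ fun x => x + v) = g + fwdDiff v g := by
    ext x; simp [fwdDiff]
  rw [h3, h1] at h2
  have h4 := congrFun h2 y
  simp only [Pi.add_apply, LinearMap.neg_apply, innerₗ_apply_apply, Circle.smul_def,
    smul_eq_mul] at h4
  change VectorFourier.fourierIntegral Real.fourierChar volume (-innerₗ E) (fwdDiff v g) y =
    _ * VectorFourier.fourierIntegral Real.fourierChar volume (-innerₗ E) g y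
  rw [sub_mul, one_mul, ← h4]
  ring

theorem fourierInv_fwdDiff_iter {g : E → ℂ} (hg : Integrable g) (v y : E) (m : ℕ) :
    𝓕⁻ ((fwdDiff v)^[m] g) y =
      ((Real.fourierChar (-inner ℝ v y) : ℂ) - 1) ^ m * 𝓕⁻ g y := by
  induction m with
  | zero => simp
  | succ m ih =>
    rw [Function.iterate_succ_apply', fourierInv_fwdDiff (integrable_fwdDiff_iter hg v m), ih,
      pow_succ]
    ring

theorem norm_fourierInv_le (g : E → ℂ) (y : E) : ‖𝓕⁻ g y‖ ≤ ∫ x, ‖g x‖ :=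
  VectorFourier.norm_fourierIntegral_le_integral_norm _ _ _ _ _

/-- Smoothness in the `L¹` sense yields decay of the Fourier transform. -/
theorem norm_fourierInv_le_of_fwdDiff {g : E → ℂ} (hg : Integrable g) (m : ℕ) {y : E} (hy : y ≠ 0) :
    2 ^ m * ‖𝓕⁻ g y‖ ≤ ∫ x, ‖(fwdDiff ((2 * ‖y‖ ^ 2)⁻¹ • y))^[m] g x‖ := by
  refine le_trans (le_of_eq ?_) (norm_fourierInv_le _ y)
  have hy' : 0 < ‖y‖ := norm_pos_iff.2 hy
  -- With this step the character equals `-1`, so every difference multiplies the transform by `-2`.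
  have h1 : inner ℝ ((2 * ‖y‖ ^ 2)⁻¹ • y) y = (1 / 2 : ℝ) := by
    rw [real_inner_smul_left, real_inner_self_eq_norm_sq]
    field_simp
  rw [fourierInv_fwdDiff_iter hg, h1, norm_mul, norm_pow]
  congr 2
  have h2 : (Real.fourierChar (-(1 / 2)) : ℂ) = -1 := by
    rw [Real.fourierChar_apply]
    have : ((2 * Real.pi * -(1 / 2) : ℝ) : ℂ) * Complex.I = -(Real.pi * Complex.I) := by
      push_cast; ring
    rw [this, Complex.exp_neg, Complex.exp_pi_mul_I]
    norm_num
  rw [h2]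
  norm_num

theorem fwdDiff_iter_ofReal {M : Type*} [AddCommMonoid M] (f : M → ℝ) (v : M) (m : ℕ) :
    (fwdDiff v)^[m] (fun x => (f x : ℂ)) = fun x => (((fwdDiff v)^[m] f x : ℝ) : ℂ) := by
  induction m with
  | zero => rfl
  | succ m ih =>
    rw [Function.iterate_succ_apply', Function.iterate_succ_apply', ih]
    ext x
    simp [fwdDiff]

theorem integrable_exp_neg_of_quadratic {q : E → ℝ} (hc : Continuous q) {a : ℝ} (ha : 0 < a)
    (hqa : ∀ ξ, a * ‖ξ‖ ^ 2 ≤ q ξ) : Integrable (fun x => Real.exp (-q x)) := by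
  have h1 := (GaussianFourier.integrable_cexp_neg_mul_sq_norm_add (V := E) (b := (a : ℂ))
    (by simpa using ha) 0 0).norm
  refine h1.mono' (by fun_prop) (Filter.Eventually.of_forall fun x => ?_)
  rw [Real.norm_of_nonneg (Real.exp_pos _).le, Complex.norm_exp]
  refine Real.exp_le_exp.2 ?_
  have := hqa x
  norm_cast
  simp
  linarith

/-- Take `d + 3` differences with step length `ρ = 1 / (2‖y‖)`. After rescaling by `ρ` they are
bounded by `ρ ^ 2` times the integrable weight `(1 + ‖η‖) ^ (-(d + 1))`; the Jacobian adds `ρ ^ d`,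
whence `‖y‖ ^ (-(d + 2))`. -/
theorem exists_norm_fourierInv_exp_neg_le {q : E → ℝ} (hc : Continuous q)
    (hq : ContDiffOn ℝ ∞ q {0}ᶜ) (hom : ∀ t : ℝ, 0 < t → ∀ ξ, q (t • ξ) = t ^ 2 * q ξ)
    {a b : ℝ} (ha : 0 < a) (hqa : ∀ ξ, a * ‖ξ‖ ^ 2 ≤ q ξ) (hqb : ∀ ξ, q ξ ≤ b * ‖ξ‖ ^ 2)
    (hb : 0 ≤ b) :
    ∃ C : ℝ, 0 ≤ C ∧ ∀ y : E, ‖𝓕⁻ (fun x => ((Real.exp (-q x) : ℝ) : ℂ)) y‖ ≤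
      C * (1 + ‖y‖) ^ (-((Module.finrank ℝ E : ℝ) + 2)) := by
  set d := Module.finrank ℝ E with hd
  obtain ⟨C, hC0, hC⟩ := exists_abs_fwdDiff_iter_exp_neg_le hq hom ha hqa hqb hb d
  have hint := integrable_exp_neg_of_quadratic hc ha hqa
  have hint' : Integrable (fun x => ((Real.exp (-q x) : ℝ) : ℂ)) := hint.ofReal
  set I : ℝ := ∫ x : E, (1 + ‖x‖) ^ (-((d : ℝ) + 1)) with hI
  have hIint : Integrable (fun x : E => (1 + ‖x‖) ^ (-((d : ℝ) + 1))) :=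
    integrable_one_add_norm (by rw [← hd]; linarith)
  have hI0 : 0 ≤ I := integral_nonneg fun x => by positivity
  set J : ℝ := ∫ x : E, ‖((Real.exp (-q x) : ℝ) : ℂ)‖ with hJ
  have hJ0 : 0 ≤ J := integral_nonneg fun x => norm_nonneg _
  have key : ∀ y : E, y ≠ 0 →
      ‖𝓕⁻ (fun x => ((Real.exp (-q x) : ℝ) : ℂ)) y‖ * ‖y‖ ^ (d + 2) ≤ C * I := by
    intro y hy
    have hy' : 0 < ‖y‖ := norm_pos_iff.2 hy
    set v : E := (2 * ‖y‖ ^ 2)⁻¹ • y with hv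
    set ρ : ℝ := (2 * ‖y‖)⁻¹ with hρ
    have hρ0 : 0 < ρ := by positivity
    have hvρ : ‖v‖ = ρ := by
      rw [hv, norm_smul, Real.norm_of_nonneg (by positivity), hρ]
      field_simp
    have h1 := norm_fourierInv_le_of_fwdDiff hint' (d + 3) hy
    rw [← hv, fwdDiff_iter_ofReal] at h1
    have h2 : (∫ x : E, ‖(((fwdDiff v)^[d + 3] (fun x => Real.exp (-q x)) x : ℝ) : ℂ)‖) ≤
        ρ ^ d * (C * ρ ^ 2 * I) := by
      have h3 := Measure.integral_comp_smul (volume : Measure E)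
        (fun x => ‖(((fwdDiff v)^[d + 3] (fun x => Real.exp (-q x)) x : ℝ) : ℂ)‖) ρ
      rw [← hd, abs_of_pos (by positivity), smul_eq_mul, eq_inv_mul_iff_mul_eq₀ (by positivity)] at h3
      rw [← h3]
      gcongr
      rw [hI, ← integral_const_mul]
      refine integral_mono_of_nonneg (Filter.Eventually.of_forall fun x => norm_nonneg _)
        (hIint.const_mul _) (Filter.Eventually.of_forall fun x => ?_)
      have h4 := hC ρ hρ0 v hvρ x
      rw [← le_div_iff₀ (by positivity)] at h4
      simp only [Complex.norm_real, Real.norm_eq_abs]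
      refine h4.trans (le_of_eq ?_)
      rw [Real.rpow_neg (by positivity), div_eq_mul_inv]
      norm_cast
    have h5 := h1.trans h2
    have h6 : (1 : ℝ) ≤ 2 ^ (d + 3) := one_le_pow₀ (by norm_num)
    have h7 : ρ ^ d * (C * ρ ^ 2 * I) * ‖y‖ ^ (d + 2) ≤ C * I := by
      have : ρ ^ d * (C * ρ ^ 2 * I) * ‖y‖ ^ (d + 2) = C * I * (1 / 2) ^ (d + 2) := by
        rw [hρ, one_div, inv_pow, inv_pow, inv_pow, mul_pow, mul_pow, pow_add, pow_add]
        field_simp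
      rw [this]
      exact mul_le_of_le_one_right (by positivity) (pow_le_one₀ (by norm_num) (by norm_num))
    refine le_trans ?_ h7
    gcongr
    exact le_trans (le_mul_of_one_le_left (norm_nonneg _) h6) h5
  refine ⟨2 ^ (d + 2) * (J + C * I), by positivity, fun y => ?_⟩
  rw [Real.rpow_neg (by positivity), ← div_eq_mul_inv, le_div_iff₀ (by positivity)]
  have hcast : (1 + ‖y‖) ^ ((d : ℝ) + 2) = (1 + ‖y‖) ^ (d + 2) := by norm_cast
  rw [hcast]
  have hJb := norm_fourierInv_le (fun x => ((Real.exp (-q x) : ℝ) : ℂ)) y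
  rcases le_or_gt ‖y‖ 1 with h | h
  · calc _ ≤ J * (2 : ℝ) ^ (d + 2) := by gcongr; linarith
      _ ≤ _ := by
        rw [mul_comm]
        have : 0 ≤ C * I := by positivity
        gcongr; linarith
  · have hy : y ≠ 0 := norm_pos_iff.1 (by linarith)
    calc _ ≤ ‖𝓕⁻ (fun x => ((Real.exp (-q x) : ℝ) : ℂ)) y‖ * (2 * ‖y‖) ^ (d + 2) := by
          gcongr; linarith
      _ = 2 ^ (d + 2) * (‖𝓕⁻ (fun x => ((Real.exp (-q x) : ℝ) : ℂ)) y‖ * ‖y‖ ^ (d + 2)) := by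
          rw [mul_pow]; ring
      _ ≤ _ := by
        have := key y hy
        gcongr; linarith

/-- Cartesian coordinates adapted to a unit vector and its orthogonal hyperplane. -/
def hyperplaneProd (n : E) (hn : ‖n‖ = 1) : (Submodule.span ℝ {n})ᗮ × ℝ ≃ᵐ E :=
  ((MeasurableEquiv.prodCongr (MeasurableEquiv.refl _)
    (LinearIsometryEquiv.toSpanUnitSingleton n hn).toHomeomorph.toMeasurableEquiv).trans
    MeasurableEquiv.prodComm).trans
  ((MeasurableEquiv.toLp 2 _).trans
    (Submodule.span ℝ {n}).orthogonalDecomposition.symm.toHomeomorph.toMeasurableEquiv)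

theorem hyperplaneProd_apply (n : E) (hn : ‖n‖ = 1) (x : (Submodule.span ℝ {n})ᗮ × ℝ) :
    hyperplaneProd n hn x = (x.1 : E) + x.2 • n := by
  have h : hyperplaneProd n hn x = x.2 • n + (x.1 : E) := by
    simp only [hyperplaneProd, MeasurableEquiv.trans_apply]
    simp
    rfl
  rw [h, add_comm]

theorem measurePreserving_hyperplaneProd (n : E) (hn : ‖n‖ = 1) :
    MeasurePreserving (hyperplaneProd n hn) (volume.prod volume) volume := by
  refine MeasurePreserving.trans (MeasurePreserving.trans (μb := volume.prod volume) ?_ ?_)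
    (MeasurePreserving.trans (μb := volume) (WithLp.volume_preserving_toLp _ _)
      (LinearIsometryEquiv.measurePreserving _))
  · exact (MeasurePreserving.id _).prod (LinearIsometryEquiv.measurePreserving _)
  · exact Measure.measurePreserving_swap

theorem integral_eq_integral_hyperplane {G : Type*} [NormedAddCommGroup G] [NormedSpace ℝ G]
    (n : E) (hn : ‖n‖ = 1) {g : E → G} (hg : Integrable g) :
    ∫ x, g x = ∫ w : (Submodule.span ℝ {n})ᗮ, ∫ r : ℝ, g ((w : E) + r • n) := by
  rw [← (measurePreserving_hyperplaneProd n hn).integral_comp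
    (hyperplaneProd n hn).measurableEmbedding g, integral_prod]
  · simp only [hyperplaneProd_apply]
  · exact (measurePreserving_hyperplaneProd n hn).integrable_comp_of_integrable hg

end Fourier

/-! ### Bounds, homogeneity and continuity of the dual metric -/

section Dual

variable {d : ℕ} {φ : EuclideanSpace ℝ (Fin d) → ℝ}

theorem IsFinslerMetric.exists_dualMetric_bounds (hφ : IsFinslerMetric φ) :
    ∃ a b : ℝ, 0 < a ∧ 0 < b ∧ ∀ η, a * ‖η‖ ≤ dualMetric φ η ∧ dualMetric φ η ≤ b * ‖η‖ := by
  obtain ⟨a, b, ha, hab, h⟩ := hφ.bounds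
  have hb : 0 < b := ha.trans_le hab
  have h0 : φ 0 = 0 := by simpa using hφ.homogeneous 0 0
  refine ⟨b⁻¹, a⁻¹, by positivity, by positivity, fun η => ?_⟩
  have hup : ∀ r ∈ {r : ℝ | ∃ ξ, φ ξ ≤ 1 ∧ r = inner ℝ η ξ}, r ≤ a⁻¹ * ‖η‖ := by
    rintro r ⟨ξ, hξ, rfl⟩
    have h1 : ‖ξ‖ ≤ a⁻¹ := by
      rw [← one_div, le_div_iff₀ ha]
      linarith [(h ξ).1]
    calc inner ℝ η ξ ≤ ‖η‖ * ‖ξ‖ := real_inner_le_norm _ _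
      _ ≤ ‖η‖ * a⁻¹ := by gcongr
      _ = _ := mul_comm _ _
  refine ⟨?_, csSup_le ⟨0, 0, by simp [h0], by simp⟩ hup⟩
  rcases eq_or_ne η 0 with rfl | hη
  · exact le_csSup ⟨_, hup⟩ ⟨0, by simp [h0], by simp⟩
  · have hη' : 0 < ‖η‖ := norm_pos_iff.2 hη
    refine le_csSup ⟨_, hup⟩ ⟨(b * ‖η‖)⁻¹ • η, ?_, ?_⟩
    · rw [hφ.homogeneous, abs_of_pos (by positivity), inv_mul_le_iff₀ (by positivity), mul_one]
      exact (h η).2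
    · rw [real_inner_smul_right, real_inner_self_eq_norm_sq]
      field_simp

theorem dualMetric_smul {t : ℝ} (ht : 0 < t) (η : EuclideanSpace ℝ (Fin d)) :
    dualMetric φ (t • η) = t * dualMetric φ η := by
  unfold dualMetric
  rw [← smul_eq_mul, ← Real.sSup_smul_of_nonneg ht.le]
  congr 1
  ext r
  simp only [Set.mem_ofPred_eq, Set.mem_smul_set]
  constructor
  · rintro ⟨ξ, hξ, rfl⟩
    exact ⟨_, ⟨ξ, hξ, rfl⟩, by rw [real_inner_smul_left, smul_eq_mul]⟩
  · rintro ⟨_, ⟨ξ, hξ, rfl⟩, rfl⟩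
    exact ⟨ξ, hξ, by rw [real_inner_smul_left, smul_eq_mul]⟩

theorem IsFinslerMetric.dualMetric_neg (hφ : IsFinslerMetric φ) (η : EuclideanSpace ℝ (Fin d)) :
    dualMetric φ (-η) = dualMetric φ η := by
  have hn : ∀ ξ, φ (-ξ) = φ ξ := fun ξ => by simpa using hφ.homogeneous (-1) ξ
  unfold dualMetric
  congr 1
  ext r
  constructor
  · rintro ⟨ξ, hξ, rfl⟩
    exact ⟨-ξ, by rwa [hn], by simp⟩
  · rintro ⟨ξ, hξ, rfl⟩
    exact ⟨-ξ, by rwa [hn], by simp⟩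

theorem IsFinslerMetric.continuous_dualMetric (hφ : IsFinslerMetric φ)
    (hdual : ContDiffOn ℝ ∞ (dualMetric φ) {0}ᶜ) : Continuous (dualMetric φ) := by
  obtain ⟨a, b, ha, hb, h⟩ := hφ.exists_dualMetric_bounds
  rw [continuous_iff_continuousAt]
  intro η
  rcases eq_or_ne η 0 with rfl | hη
  · have h0 : dualMetric φ 0 = 0 := by
      have := h 0
      simp at this
      linarith
    rw [ContinuousAt, h0]
    refine squeeze_zero (fun η => le_trans (by positivity) (h η).1) (fun η => (h η).2) ?_
    have : Filter.Tendsto (fun η : EuclideanSpace ℝ (Fin d) => b * ‖η‖) (nhds 0) (nhds (b * ‖(0 : EuclideanSpace ℝ (Fin d))‖)) :=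
      Continuous.tendsto (by fun_prop) _
    simpa using this
  · exact hdual.continuousOn.continuousAt (isOpen_compl_singleton.mem_nhds hη)

end Dual

/-! ### Kernel properties and the Fourier slice theorem -/

/-- The properties of the anisotropic heat kernel at time `1` that enter the consistency
argument. -/
structure IsConsistentKernel {E : Type} [NormedAddCommGroup E] [InnerProductSpace ℝ E]
    [FiniteDimensional ℝ E] [MeasurableSpace E] [BorelSpace E] (K : E → ℝ) : Prop where
  continuous : Continuous K
  even : ∀ y, K (-y) = K y
  decay : ∃ C : ℝ, 0 ≤ C ∧ ∀ y, |K y| ≤ C * (1 + ‖y‖) ^ (-((Module.finrank ℝ E : ℝ) + 2))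
  integral_eq_one : ∫ y, K y = 1
  hyperplane_pos : ∀ n : E, ‖n‖ = 1 → 0 < ∫ w : (Submodule.span ℝ {n})ᗮ, K w

section KernelFacts

variable {E : Type} [NormedAddCommGroup E] [InnerProductSpace ℝ E] [FiniteDimensional ℝ E]
  [MeasurableSpace E] [BorelSpace E]

theorem continuous_fourierInv {g : E → ℂ} (hg : Integrable g) : Continuous (𝓕⁻ g) := by
  have hL : Continuous fun p : E × E => (-innerₗ E) p.1 p.2 := by
    simp only [LinearMap.neg_apply, innerₗ_apply_apply]
    fun_prop
  exact VectorFourier.fourierIntegral_continuous Real.continuous_fourierChar hL hg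

omit [MeasurableSpace E] [BorelSpace E] in
theorem finrank_hyperplane (n : E) (hn : ‖n‖ = 1) :
    (Module.finrank ℝ (Submodule.span ℝ {n})ᗮ : ℝ) + 1 = Module.finrank ℝ E := by
  have h1 := (Submodule.span ℝ {n}).finrank_add_finrank_orthogonal
  rw [finrank_span_singleton (by rintro rfl; simp at hn)] at h1
  rw [← h1]; push_cast; ring

omit [FiniteDimensional ℝ E] [MeasurableSpace E] [BorelSpace E] in
theorem norm_le_norm_add_smul (n : E) (w : (Submodule.span ℝ {n})ᗮ) (r : ℝ) :
    ‖w‖ ≤ ‖(w : E) + r • n‖ := by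
  have h1 : inner ℝ (w : E) (r • n) = 0 := by
    rw [real_inner_smul_right, Submodule.inner_left_of_mem_orthogonal
      (Submodule.mem_span_singleton_self n) w.2, mul_zero]
  have h2 := norm_add_sq_real (w : E) (r • n)
  rw [h1] at h2
  have h3 : ‖(w : E)‖ ^ 2 ≤ ‖(w : E) + r • n‖ ^ 2 := by nlinarith [sq_nonneg ‖r • n‖]
  exact le_of_sq_le_sq h3 (norm_nonneg _)

/-- The Fourier slice theorem. -/
theorem integral_hyperplane_eq_integral_fourier {k : E → ℂ} (hk : Continuous k) {C : ℝ}
    (hC : ∀ y, ‖k y‖ ≤ C * (1 + ‖y‖) ^ (-((Module.finrank ℝ E : ℝ) + 2)))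
    (hC0 : 0 ≤ C)
    (n : E) (hn : ‖n‖ = 1) (hint : Integrable (fun t : ℝ => 𝓕 k (t • n))) :
    ∫ w : (Submodule.span ℝ {n})ᗮ, k w = ∫ t : ℝ, 𝓕 k (t • n) := by
  have hkint : Integrable k :=
    ((integrable_one_add_norm (r := (Module.finrank ℝ E : ℝ) + 2) (by linarith)).const_mul C).mono'
      hk.aestronglyMeasurable (Filter.Eventually.of_forall hC)
  -- The integral over the parallel hyperplane at height `r`. Its one-dimensional transform is `𝓕 k`
  -- on the line spanned by `n`; continuity of `g` allows Fourier inversion at the single point `r =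
  -- 0`.
  set g : ℝ → ℂ := fun r => ∫ w : (Submodule.span ℝ {n})ᗮ, k ((w : E) + r • n) with hg
  have hprod : Integrable (fun p : (Submodule.span ℝ {n})ᗮ × ℝ => k ((p.1 : E) + p.2 • n))
      (volume.prod volume) := by
    have := (measurePreserving_hyperplaneProd n hn).integrable_comp_of_integrable hkint
    simpa only [Function.comp_def, hyperplaneProd_apply] using this
  have hgint : Integrable g := hprod.integral_prod_right
  have hgc : Continuous g := by
    refine continuous_of_dominated (bound := fun w : (Submodule.span ℝ {n})ᗮ =>
      C * (1 + ‖w‖) ^ (-((Module.finrank ℝ E : ℝ) + 2))) (fun r => ?_) (fun r => ?_) ?_ ?_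
    · exact Continuous.aestronglyMeasurable (by fun_prop)
    · refine Filter.Eventually.of_forall fun w => (hC _).trans ?_
      gcongr C * ?_
      refine Real.rpow_le_rpow_of_nonpos (by positivity) ?_ (by have : (0 : ℝ) ≤ Module.finrank ℝ E := by positivity
                                                                linarith)
      linarith [norm_le_norm_add_smul n w r]
    · exact (integrable_one_add_norm (by linarith [finrank_hyperplane n hn])).const_mul C
    · exact Filter.Eventually.of_forall fun w => by fun_prop
  have hF : ∀ t, 𝓕 g t = 𝓕 k (t • n) := by
    intro t
    have h1 : Integrable (fun y => Real.fourierChar (-inner ℝ y (t • n)) • k y) :=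
      (Real.fourierIntegral_convergent_iff _).2 hkint
    rw [Real.fourier_eq, Real.fourier_eq, integral_eq_integral_hyperplane n hn h1,
      integral_integral_swap]
    · refine integral_congr_ae (Filter.Eventually.of_forall fun r => ?_)
      simp only [hg, Circle.smul_def, smul_eq_mul]
      rw [← integral_const_mul]
      refine integral_congr_ae (Filter.Eventually.of_forall fun w => ?_)
      simp only
      congr 3
      rw [inner_add_left, real_inner_smul_right, Submodule.inner_left_of_mem_orthogonal
        (Submodule.mem_span_singleton_self n) w.2, real_inner_smul_right, real_inner_smul_left,
        real_inner_self_eq_norm_sq, hn]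
      simp
    · have := (measurePreserving_hyperplaneProd n hn).integrable_comp_of_integrable h1
      simpa only [Function.comp_def, hyperplaneProd_apply, Function.uncurry_def] using this
  have h2 : Integrable (𝓕 g) := by
    rw [show 𝓕 g = fun t => 𝓕 k (t • n) from funext hF]; exact hint
  have h3 := congrFun (hgc.fourierInv_fourier_eq hgint h2) 0
  rw [Real.fourierInv_eq] at h3
  simp only [inner_zero_right, AddChar.map_zero_eq_one, one_smul, hF] at h3
  rw [h3, hg]
  simp

/-- Decay makes the kernel integrable, and evenness identifies `𝓕 F` with `𝓕⁻ F`, so Fourier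
inversion applies. At the origin it gives total mass `exp(-q 0) = 1`; on lines it turns hyperplane
integrals into integrals of a positive function. -/
theorem isConsistentKernel_of_fourier {q : E → ℝ} (hc : Continuous q) (heven : ∀ ξ, q (-ξ) = q ξ)
    (hq : ContDiffOn ℝ ∞ q {0}ᶜ) (hom : ∀ t : ℝ, 0 < t → ∀ ξ, q (t • ξ) = t ^ 2 * q ξ)
    {a b : ℝ} (ha : 0 < a) (hqa : ∀ ξ, a * ‖ξ‖ ^ 2 ≤ q ξ) (hqb : ∀ ξ, q ξ ≤ b * ‖ξ‖ ^ 2)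
    (hb : 0 ≤ b) :
    IsConsistentKernel (fun y : E => (𝓕⁻ (fun x => ((Real.exp (-q x) : ℝ) : ℂ)) y).re) := by
  set F : E → ℂ := fun x => ((Real.exp (-q x) : ℝ) : ℂ) with hF
  have hFint : Integrable F := (integrable_exp_neg_of_quadratic hc ha hqa).ofReal
  have hFc : Continuous F := by fun_prop
  have hcont := continuous_fourierInv hFint
  obtain ⟨C, hC0, hC⟩ := exists_norm_fourierInv_exp_neg_le hc hq hom ha hqa hqb hb
  have hkint : Integrable (𝓕⁻ F) :=
    ((integrable_one_add_norm (r := (Module.finrank ℝ E : ℝ) + 2) (by linarith)).const_mul C).mono'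
      hcont.aestronglyMeasurable (Filter.Eventually.of_forall hC)
  have hev : ∀ y, 𝓕⁻ F (-y) = 𝓕⁻ F y := by
    intro y
    have h1 : (F ∘ LinearIsometryEquiv.neg ℝ) = F := by
      ext x; simp [hF, heven]
    have h2 := Real.fourierInv_comp_linearIsometry (LinearIsometryEquiv.neg ℝ) F y
    rw [h1] at h2
    simpa using h2.symm
  have hFint' : Integrable (𝓕 F) := by
    have h1 : 𝓕 F = 𝓕⁻ F := by
      ext y
      rw [← hev, Real.fourierInv_eq_fourier_neg, neg_neg]
    rw [h1]; exact hkint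
  have hinv : 𝓕 (𝓕⁻ F) = F := hFc.fourier_fourierInv_eq hFint hFint'
  have h0 : q 0 = 0 := by
    have := hqa 0; have := hqb 0
    simp at *
    linarith
  refine ⟨Complex.continuous_re.comp hcont, fun y => by simp only [hev], ⟨C, hC0, fun y =>
    (Complex.abs_re_le_norm _).trans (hC y)⟩, ?_, fun n hn => ?_⟩
  · have h1 := congrFun hinv 0
    rw [Real.fourier_eq] at h1
    simp only [inner_zero_right, neg_zero, AddChar.map_zero_eq_one, one_smul] at h1
    have h2 := integral_re hkint
    simp only [RCLike.re_eq_complex_re] at h2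
    rw [h2, h1, hF]
    simp [h0]
  · have hint1 : Integrable (fun t : ℝ => Real.exp (-q (t • n))) :=
      integrable_exp_neg_of_quadratic (by fun_prop) ha fun t => by
        simpa [norm_smul, hn] using hqa (t • n)
    have h1 := integral_hyperplane_eq_integral_fourier hcont hC hC0 n hn (by
      rw [hinv]; exact hint1.ofReal)
    rw [hinv] at h1
    have hwint : Integrable (fun w : (Submodule.span ℝ {n})ᗮ => 𝓕⁻ F w) := by
      refine ((integrable_one_add_norm (r := (Module.finrank ℝ E : ℝ) + 2)
        (by linarith [finrank_hyperplane n hn])).const_mul C).mono'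
        (Continuous.aestronglyMeasurable (by fun_prop)) (Filter.Eventually.of_forall fun w => ?_)
      exact hC w
    have h2 := integral_re hwint
    simp only [RCLike.re_eq_complex_re] at h2
    rw [h2, h1, hF]
    simp only
    rw [integral_complex_ofReal, Complex.ofReal_re]
    exact integral_exp_pos hint1

end KernelFacts

/-! ### Parabolic scaling of the kernel -/

section Scaling

variable {d : ℕ} {φ : EuclideanSpace ℝ (Fin d) → ℝ}

theorem IsFinslerMetric.isConsistentKernel (hφ : IsFinslerMetric φ)
    (hdual : ContDiffOn ℝ ∞ (dualMetric φ) {0}ᶜ) : IsConsistentKernel (kernel φ 1) := by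
  obtain ⟨a, b, ha, hb, h⟩ := hφ.exists_dualMetric_bounds
  have hc := hφ.continuous_dualMetric hdual
  have h0 : ∀ η, 0 ≤ dualMetric φ η := fun η => le_trans (by positivity) (h η).1
  have h1 := isConsistentKernel_of_fourier (q := fun ξ => 4 * Real.pi ^ 2 * dualMetric φ ξ ^ 2)
    (a := 4 * Real.pi ^ 2 * a ^ 2) (b := 4 * Real.pi ^ 2 * b ^ 2)
    (by fun_prop) (fun ξ => by rw [hφ.dualMetric_neg])
    (contDiffOn_const.mul (hdual.pow 2)) (fun t ht ξ => by rw [dualMetric_smul ht]; ring)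
    (by positivity)
    (fun ξ => by
      calc _ = 4 * Real.pi ^ 2 * (a * ‖ξ‖) ^ 2 := by ring
        _ ≤ _ := by gcongr; exact (h ξ).1)
    (fun ξ => by
      calc _ ≤ 4 * Real.pi ^ 2 * (b * ‖ξ‖) ^ 2 := by gcongr; exacts [h0 ξ, (h ξ).2]
        _ = _ := by ring)
    (by positivity)
  have h2 : (fun ξ => ((Real.exp (-4 * Real.pi ^ 2 * 1 * dualMetric φ ξ ^ 2) : ℝ) : ℂ)) =
      fun ξ => ((Real.exp (-(4 * Real.pi ^ 2 * dualMetric φ ξ ^ 2)) : ℝ) : ℂ) := by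
    funext ξ
    congr 2
    ring
  rw [← h2] at h1
  exact h1

theorem kernel_eq_scale {h : ℝ} (hh : 0 < h) (x : EuclideanSpace ℝ (Fin d)) :
    kernel φ h x = (√h ^ d)⁻¹ * kernel φ 1 ((√h)⁻¹ • x) := by
  have hs : 0 < √h := Real.sqrt_pos.2 hh
  unfold kernel
  rw [Real.fourierInv_eq, Real.fourierInv_eq]
  have h1 := Measure.integral_comp_smul (volume : Measure (EuclideanSpace ℝ (Fin d)))
    (fun v => Real.fourierChar (inner ℝ v ((√h)⁻¹ • x)) •
      ((Real.exp (-4 * Real.pi ^ 2 * 1 * dualMetric φ v ^ 2) : ℝ) : ℂ)) (√h)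
  rw [finrank_euclideanSpace_fin, abs_of_pos (by positivity)] at h1
  have h2 := congrArg Complex.re h1
  rw [Complex.real_smul, Complex.re_ofReal_mul] at h2
  rw [← h2]
  congr 2
  ext v
  rw [real_inner_smul_left, real_inner_smul_right, mul_inv_cancel_left₀ hs.ne',
    dualMetric_smul hs, mul_pow, Real.sq_sqrt hh.le]
  congr 3
  ring

/-- Moves all dependence on `h` from the kernel into the set, so that a single fixed kernel enters
the asymptotics. -/
theorem levelValue_eq_integral {h : ℝ} (hh : 0 < h) (ψ : EuclideanSpace ℝ (Fin d) → ℝ) (s : ℝ)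
    (x : EuclideanSpace ℝ (Fin d)) :
    levelValue φ h ψ s x =
      ∫ y, kernel φ 1 y * Set.indicator {y | s ≤ ψ y} (fun _ => 1) (x - √h • y) := by
  have hs : 0 < √h := Real.sqrt_pos.2 hh
  unfold levelValue convOp
  have h1 := Measure.integral_comp_smul (volume : Measure (EuclideanSpace ℝ (Fin d)))
    (fun y => kernel φ h y * Set.indicator {y | s ≤ ψ y} (fun _ => (1 : ℝ)) (x - y)) (√h)
  rw [finrank_euclideanSpace_fin, abs_of_pos (by positivity), smul_eq_mul,
    eq_inv_mul_iff_mul_eq₀ (by positivity), ← integral_const_mul] at h1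
  rw [← h1]
  congr 1
  ext y
  rw [kernel_eq_scale hh, smul_smul, inv_mul_cancel₀ hs.ne', one_smul]
  field_simp

end Scaling

/-! ### Locally uniform second order Taylor expansion -/

section Taylor

variable {E : Type} [NormedAddCommGroup E] [InnerProductSpace ℝ E] [FiniteDimensional ℝ E]
  [MeasurableSpace E] [BorelSpace E]

omit [MeasurableSpace E] [BorelSpace E] in
theorem contDiff_gradient {ψ : E → ℝ} (hψ : ContDiff ℝ 2 ψ) : ContDiff ℝ 1 (fun y => ∇ ψ y) :=
  (InnerProductSpace.toDual ℝ E).symm.contDiff.comp (hψ.fderiv_right (m := 1) (by norm_num))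

omit [MeasurableSpace E] [BorelSpace E] in
/-- The second order Taylor expansion at `x`, with the Hessian frozen at `z`. -/
theorem exists_taylor_bound {ψ : E → ℝ} (hψ : ContDiff ℝ 2 ψ) (z : E) {η : ℝ} (hη : 0 < η) :
    ∃ R : ℝ, 0 < R ∧ ∀ x ∈ Metric.ball z R, ∀ v : E, ‖v‖ ≤ R →
      |ψ (x - v) - ψ x + inner ℝ (∇ ψ x) v -
        1 / 2 * inner ℝ (fderiv ℝ (fun y => ∇ ψ y) z v) v| ≤ η * ‖v‖ ^ 2 := by
  have hg := contDiff_gradient hψ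
  set g : E → E := fun y => ∇ ψ y with hgdef
  set X := fderiv ℝ g z with hX
  -- Strict differentiability of the gradient compares its values at two nearby points, which is
  -- what lets the base point `x` vary while the Hessian stays at `z`.
  have hstrict : HasStrictFDerivAt g X z := hg.contDiffAt.hasStrictFDerivAt (by norm_num)
  rw [hasStrictFDerivAt_iff_isLittleO] at hstrict
  have hev := hstrict.def hη
  rw [Metric.eventually_nhds_iff] at hev
  obtain ⟨δ, hδ, hev⟩ := hev
  refine ⟨δ / 2, by positivity, fun x hx v hv => ?_⟩
  have hx' : dist x z < δ / 2 := hx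
  have hbd : ∀ t ∈ Set.Icc (0 : ℝ) 1, ‖g (x - t • v) - g x + t • X v‖ ≤ η * ‖v‖ := by
    intro t ht
    have htv : ‖t • v‖ ≤ ‖v‖ := by
      rw [norm_smul, Real.norm_of_nonneg ht.1]
      exact mul_le_of_le_one_left (norm_nonneg _) ht.2
    have h1 := @hev (x - t • v, x) (by
      rw [Prod.dist_eq, max_lt_iff]
      refine ⟨?_, by simp only; linarith⟩
      calc dist (x - t • v) z ≤ dist (x - t • v) x + dist x z := dist_triangle _ _ _
        _ < δ := by
          rw [dist_eq_norm, sub_sub_cancel_left, norm_neg]; linarith)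
    simp only [sub_sub_cancel_left, map_neg, map_smul, sub_neg_eq_add, norm_neg] at h1
    exact h1.trans (by gcongr)
  have hψd : ∀ y, HasGradientAt ψ (g y) y := fun y =>
    (hψ.differentiable (by norm_num) y).hasGradientAt
  have hder : ∀ t : ℝ, HasDerivAt (fun t : ℝ => ψ (x - t • v) - ψ x + t * inner ℝ (g x) v -
      1 / 2 * t ^ 2 * inner ℝ (X v) v)
      (-inner ℝ (g (x - t • v) - g x + t • X v) v) t := by
    intro t
    have h1 : HasDerivAt (fun t : ℝ => x - t • v) (-v) t := by
      simpa using ((hasDerivAt_id t).smul_const v).const_sub x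
    have h2 := (hψd (x - t • v)).hasFDerivAt.comp_hasDerivAt t h1
    have h3 := ((h2.sub_const (ψ x)).add ((hasDerivAt_id t).mul_const (inner ℝ (g x) v))).sub
      ((((hasDerivAt_id t).pow 2).const_mul (1 / 2 : ℝ)).mul_const (inner ℝ (X v) v))
    refine h3.congr_deriv ?_
    simp only [InnerProductSpace.toDual_apply_apply, inner_neg_right, inner_add_left,
      inner_sub_left, real_inner_smul_left, id]
    push_cast
    ring
  have := norm_image_sub_le_of_norm_deriv_le_segment_01' (C := η * ‖v‖ ^ 2)
    (fun t _ => (hder t).hasDerivWithinAt) (fun t ht => by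
      rw [norm_neg]
      refine (norm_inner_le_norm _ _).trans ?_
      have := hbd t ⟨ht.1, ht.2.le⟩
      calc _ ≤ η * ‖v‖ * ‖v‖ := by gcongr
        _ = _ := by ring)
  simpa [hgdef] using this

end Taylor

/-! ### Half-space mass and integrable majorants -/

section Kernel

variable {E : Type} [NormedAddCommGroup E] [InnerProductSpace ℝ E] [FiniteDimensional ℝ E]
  [MeasurableSpace E] [BorelSpace E] {K : E → ℝ}

theorem IsConsistentKernel.integrable (hK : IsConsistentKernel K) : Integrable K := by
  obtain ⟨C, hC0, hC⟩ := hK.decay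
  exact ((integrable_one_add_norm (r := (Module.finrank ℝ E : ℝ) + 2) (by linarith)).const_mul
    C).mono' hK.continuous.aestronglyMeasurable (Filter.Eventually.of_forall hC)

theorem integrable_mul_ite (hK : IsConsistentKernel K) {p : E → Prop} [DecidablePred p]
    (hp : MeasurableSet {y | p y}) : Integrable (fun y => K y * (if p y then 1 else 0)) := by
  have : (fun y => K y * (if p y then 1 else 0)) = {y | p y}.indicator K := by
    ext y; by_cases hy : p y <;> simp [hy]
  rw [this]
  exact hK.integrable.indicator hp

/-- Reflection `y ↦ -y` exchanges the two closed half-spaces, which cover the space and overlap in a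
null hyperplane. -/
theorem IsConsistentKernel.integral_halfspace (hK : IsConsistentKernel K) {a : E} (ha : a ≠ 0) :
    ∫ y, K y * (if inner ℝ a y ≤ 0 then 1 else 0) = 1 / 2 := by
  have h1 := integrable_mul_ite hK (p := fun y => inner ℝ a y ≤ 0)
    (measurableSet_le (by fun_prop) (by fun_prop))
  have h2 := integrable_mul_ite hK (p := fun y => 0 ≤ inner ℝ a y)
    (measurableSet_le (by fun_prop) (by fun_prop))
  have h3 : ∫ y, K y * (if inner ℝ a y ≤ 0 then 1 else 0) =
      ∫ y, K y * (if 0 ≤ inner ℝ a y then 1 else 0) := by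
    rw [← integral_neg_eq_self]
    refine integral_congr_ae (Filter.Eventually.of_forall fun y => ?_)
    simp only [hK.even, inner_neg_right, neg_nonpos]
  have h4 : ∀ᵐ y : E, inner ℝ a y ≠ 0 := by
    have h5 : (volume : Measure E) ((Submodule.span ℝ {a})ᗮ : Submodule ℝ E) = 0 := by
      refine Measure.addHaar_submodule _ _ fun h => ha ?_
      have h6 : a ∈ (Submodule.span ℝ {a})ᗮ := by rw [h]; trivial
      exact inner_self_eq_zero.1
        (Submodule.inner_right_of_mem_orthogonal (Submodule.mem_span_singleton_self a) h6)
    refine measure_mono_null (fun y hy => ?_) h5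
    simp only [ne_eq, not_not, Set.mem_compl_iff, Set.mem_ofPred_eq] at hy
    exact Submodule.mem_orthogonal_singleton_iff_inner_right.2 hy
  have h7 : (∫ y, K y * (if inner ℝ a y ≤ 0 then 1 else 0)) +
      ∫ y, K y * (if 0 ≤ inner ℝ a y then 1 else 0) = 1 := by
    rw [← integral_add h1 h2]
    refine Eq.trans (integral_congr_ae ?_) hK.integral_eq_one
    filter_upwards [h4] with y hy
    rcases lt_or_gt_of_ne hy with h | h
    · simp [h.le, not_le.2 h]
    · simp [h.le, not_le.2 h]
  linarith

/-- The parabolic decay of the kernel, in the form needed for dominated convergence. -/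
theorem IsConsistentKernel.exists_parabolic_bound (hK : IsConsistentKernel K)
    (hd : 1 ≤ Module.finrank ℝ E) {C₀ : ℝ} (hC₀ : 1 ≤ C₀) :
    ∃ C : ℝ, 0 ≤ C ∧ ∀ (y : E) (r τ : ℝ), 0 ≤ r → r ≤ ‖y‖ → |τ| ≤ C₀ * (1 + ‖y‖) ^ 2 →
      |K y| ≤ C * ((1 + r) ^ (-((Module.finrank ℝ E : ℝ) - 1 / 2)) *
        (1 + ‖τ‖) ^ (-(5 / 4 : ℝ))) := by
  obtain ⟨C, hC0, hC⟩ := hK.decay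
  have hd' : (1 : ℝ) ≤ Module.finrank ℝ E := by exact_mod_cast hd
  set d : ℝ := ((Module.finrank ℝ E : ℕ) : ℝ) with hdef
  refine ⟨C * (2 * C₀) ^ (5 / 4 : ℝ), by positivity, fun y r τ hr hry hτ => (hC y).trans ?_⟩
  rw [mul_assoc]
  gcongr C * ?_
  have hy : 0 < 1 + ‖y‖ := by positivity
  -- Split `d + 2 = (d - 1/2) + 2 · (5/4)`: the first exponent exceeds `d - 1`, for integrability on
  -- the hyperplane, and `5/4 > 1` does the same on the line.
  have h1 : (1 + ‖y‖) ^ (-(d + 2)) =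
      (1 + ‖y‖) ^ (-(d - 1 / 2)) * ((1 + ‖y‖) ^ 2) ^ (-(5 / 4 : ℝ)) := by
    rw [← Real.rpow_natCast, ← Real.rpow_mul hy.le, ← Real.rpow_add hy]
    congr 1
    push_cast
    ring
  have h2 : (1 + ‖y‖) ^ (-(d - 1 / 2)) ≤ (1 + r) ^ (-(d - 1 / 2)) :=
    Real.rpow_le_rpow_of_nonpos (by positivity) (by linarith) (by linarith)
  have h3 : (1 + ‖τ‖) / (2 * C₀) ≤ (1 + ‖y‖) ^ 2 := by
    rw [div_le_iff₀ (by positivity), Real.norm_eq_abs]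
    nlinarith [norm_nonneg y, mul_nonneg (sub_nonneg.2 hC₀) (norm_nonneg y)]
  have h4 : ((1 + ‖y‖) ^ 2) ^ (-(5 / 4 : ℝ)) ≤ ((1 + ‖τ‖) / (2 * C₀)) ^ (-(5 / 4 : ℝ)) :=
    Real.rpow_le_rpow_of_nonpos (by positivity) h3 (by norm_num)
  rw [Real.div_rpow (by positivity) (by positivity), Real.rpow_neg (by positivity : 0 ≤ 2 * C₀),
    div_inv_eq_mul] at h4
  rw [h1]
  calc _ ≤ (1 + r) ^ (-(d - 1 / 2)) * ((1 + ‖τ‖) ^ (-(5 / 4 : ℝ)) * (2 * C₀) ^ (5 / 4 : ℝ)) := by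
        gcongr
    _ = _ := by ring

theorem integrable_parabolic_bound (n : E) (hn : ‖n‖ = 1) (C : ℝ) :
    Integrable (fun x : (Submodule.span ℝ {n})ᗮ × ℝ =>
      C * ((1 + ‖x.1‖) ^ (-((Module.finrank ℝ E : ℝ) - 1 / 2)) * (1 + ‖x.2‖) ^ (-(5 / 4 : ℝ))))
      (volume.prod volume) := by
  refine Integrable.const_mul (Integrable.mul_prod
    (integrable_one_add_norm (by linarith [finrank_hyperplane n hn]))
    (integrable_one_add_norm (by norm_num))) C

theorem integral_ite_sub_ite (a : ℝ) :
    ∫ τ : ℝ, ((if τ ≤ a then (1 : ℝ) else 0) - (if τ ≤ 0 then 1 else 0)) = a := by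
  have key : ∀ b c : ℝ, b ≤ c →
      ∫ τ : ℝ, ((if τ ≤ c then (1 : ℝ) else 0) - (if τ ≤ b then 1 else 0)) = c - b := by
    intro b c hbc
    have h1 : (fun τ : ℝ => ((if τ ≤ c then (1 : ℝ) else 0) - (if τ ≤ b then 1 else 0))) =
        (Set.Ioc b c).indicator fun _ => 1 := by
      ext τ
      by_cases h1 : τ ≤ c <;> by_cases h2 : τ ≤ b <;>
        simp [Set.indicator, h1, h2, not_le.1]
      all_goals linarith
    rw [h1, integral_indicator measurableSet_Ioc]
    simp [hbc]
  rcases le_total 0 a with h | h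
  · rw [key 0 a h, sub_zero]
  · have h2 := key a 0 h
    rw [← neg_inj, ← integral_neg]
    simp only [neg_sub]
    rw [h2, zero_sub]

end Kernel

/-! ### First order expansion of the level value -/

section Asymptotics

open Filter Topology

variable {E : Type} [NormedAddCommGroup E] [InnerProductSpace ℝ E]

/-- The point with coordinates `w` and `τ` in the frame sheared along `n` so that the hyperplane
`{τ = 0}` is orthogonal to `g`. -/
def shearedPoint (g n : E) (s : ℝ) (w : E) (τ : ℝ) : E :=
  w + (-(inner ℝ g w / inner ℝ g n) + s * τ) • n

theorem inner_shearedPoint {g n : E} (hgn : inner ℝ g n ≠ 0) (s : ℝ) (w : E) (τ : ℝ) :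
    inner ℝ g (shearedPoint g n s w τ) = s * τ * inner ℝ g n := by
  rw [shearedPoint, inner_add_right, real_inner_smul_right]
  field_simp
  ring

/-- On each line parallel to `n` the shear is a translation and the stretching has Jacobian `s`. The
frame stays fixed while the tangent plane, orthogonal to `g`, moves with `x`; all integrals thus
live on one space and dominated convergence can be used. -/
theorem integral_eq_integral_shearedPoint [FiniteDimensional ℝ E] [MeasurableSpace E]
    [BorelSpace E] (g n : E) (hn : ‖n‖ = 1) {s : ℝ} (hs : 0 < s) {u : E → ℝ} (hu : Integrable u) :
    ∫ y, u y = s * ∫ w : (Submodule.span ℝ {n})ᗮ, ∫ τ : ℝ, u (shearedPoint g n s w τ) := by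
  rw [integral_eq_integral_hyperplane n hn hu, ← integral_const_mul]
  refine integral_congr_ae (Eventually.of_forall fun w => ?_)
  simp only [shearedPoint]
  have h1 := Measure.integral_comp_mul_left
    (fun r : ℝ => u ((w : E) + (-(inner ℝ g (w : E) / inner ℝ g n) + r) • n)) s
  have h2 := integral_add_left_eq_self (μ := (volume : Measure ℝ))
    (fun r : ℝ => u ((w : E) + r • n)) (-(inner ℝ g (w : E) / inner ℝ g n))
  rw [h1, h2, abs_of_pos (by positivity), smul_eq_mul, mul_inv_cancel_left₀ hs.ne']

/-- The kernel weighted with the difference between a rescaled superlevel set of `ψ` and the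
tangent half-space. -/
def levelDiff (K ψ : E → ℝ) [CompleteSpace E] (σ : ℝ) (x : E) (h : ℝ) (y : E) : ℝ :=
  K y * ((if ψ x + σ * h ≤ ψ (x - √h • y) then 1 else 0) - (if inner ℝ (∇ ψ x) y ≤ 0 then 1 else 0))

variable [FiniteDimensional ℝ E] [MeasurableSpace E] [BorelSpace E] {K ψ : E → ℝ}

theorem measurable_levelDiff (hK : IsConsistentKernel K) (hψ : ContDiff ℝ 2 ψ) (σ : ℝ) (x : E)
    (h : ℝ) : Measurable (levelDiff K ψ σ x h) := by
  have h1 := hψ.continuous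
  have h2 := hK.continuous
  refine h2.measurable.mul (Measurable.sub ?_ ?_)
  · exact Measurable.ite (measurableSet_le (by fun_prop) (by fun_prop)) measurable_const
      measurable_const
  · exact Measurable.ite (measurableSet_le (by fun_prop) (by fun_prop)) measurable_const
      measurable_const

theorem integrable_levelDiff (hK : IsConsistentKernel K) (hψ : ContDiff ℝ 2 ψ) (σ : ℝ) (x : E)
    (h : ℝ) : Integrable (levelDiff K ψ σ x h) := by
  have h1 := hψ.continuous
  unfold levelDiff
  simp only [mul_sub]
  exact (integrable_mul_ite hK (measurableSet_le (by fun_prop) (by fun_prop))).sub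
    (integrable_mul_ite hK (measurableSet_le (by fun_prop) (by fun_prop)))

theorem integral_levelDiff (hK : IsConsistentKernel K) (hψ : ContDiff ℝ 2 ψ) (σ : ℝ) {x : E}
    (hx : ∇ ψ x ≠ 0) (h : ℝ) :
    ∫ y, levelDiff K ψ σ x h y =
      (∫ y, K y * Set.indicator {y | ψ x + σ * h ≤ ψ y} (fun _ => 1) (x - √h • y)) - 1 / 2 := by
  have h1 := hψ.continuous
  rw [← hK.integral_halfspace hx]
  unfold levelDiff
  simp only [mul_sub]
  rw [integral_sub (integrable_mul_ite hK (measurableSet_le (by fun_prop) (by fun_prop)))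
    (integrable_mul_ite hK (measurableSet_le (by fun_prop) (by fun_prop)))]
  simp only [Set.indicator, Set.mem_ofPred_eq]

omit [MeasurableSpace E] [BorelSpace E] in
/-- Near a noncritical point the gradient stays comparable to its value there. -/
theorem eventually_gradient_bounds (hψ : ContDiff ℝ 2 ψ) {z : E} (hz : ∇ ψ z ≠ 0) :
    ∀ᶠ x in 𝓝 z, ‖∇ ψ z‖ / 2 ≤ inner ℝ (∇ ψ x) (‖∇ ψ z‖⁻¹ • ∇ ψ z) ∧
      ‖∇ ψ x‖ ≤ 2 * ‖∇ ψ z‖ := by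
  have hg := (contDiff_gradient hψ).continuous
  have hz' : 0 < ‖∇ ψ z‖ := norm_pos_iff.2 hz
  have h1 : Tendsto (fun x => inner ℝ (∇ ψ x) (‖∇ ψ z‖⁻¹ • ∇ ψ z)) (𝓝 z) (𝓝 ‖∇ ψ z‖) := by
    have h2 : inner ℝ (∇ ψ z) (‖∇ ψ z‖⁻¹ • ∇ ψ z) = ‖∇ ψ z‖ := by
      rw [real_inner_smul_right, real_inner_self_eq_norm_sq]; field_simp
    have h3 : Continuous fun x => inner ℝ (∇ ψ x) (‖∇ ψ z‖⁻¹ • ∇ ψ z) := by fun_prop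
    have := h3.tendsto z
    rwa [h2] at this
  filter_upwards [h1.eventually_const_le (by linarith : ‖∇ ψ z‖ / 2 < ‖∇ ψ z‖),
    (hg.norm.tendsto z).eventually_le_const (by linarith : ‖∇ ψ z‖ < 2 * ‖∇ ψ z‖)] with x hx1 hx2
  exact ⟨hx1, hx2⟩

omit [MeasurableSpace E] [BorelSpace E] in
/-- Where the superlevel set and the tangent half-space differ, the sheared height is at most
quadratic. -/
theorem exists_abs_le_of_levelDiff_ne_zero (hψ : ContDiff ℝ 2 ψ) {z : E} (hz : ∇ ψ z ≠ 0)
    (σ : ℝ) {n : E} (hn : n = ‖∇ ψ z‖⁻¹ • ∇ ψ z) :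
    ∃ C₀ : ℝ, 1 ≤ C₀ ∧ ∀ᶠ p : E × ℝ in 𝓝 z ×ˢ 𝓝[>] 0, ∀ (w : (Submodule.span ℝ {n})ᗮ) (τ : ℝ),
      levelDiff K ψ σ p.1 p.2 (shearedPoint (∇ ψ p.1) n (√p.2) w τ) ≠ 0 →
        |τ| ≤ C₀ * (1 + ‖shearedPoint (∇ ψ p.1) n (√p.2) w τ‖) ^ 2 := by
  obtain ⟨R, hR, hT⟩ := exists_taylor_bound hψ z one_pos
  set P := ‖∇ ψ z‖ with hP
  have hP0 : 0 < P := norm_pos_iff.2 hz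
  have hn1 : ‖n‖ = 1 := by rw [hn, norm_smul, norm_inv, norm_norm, inv_mul_cancel₀ hP0.ne']
  set X := fderiv ℝ (fun y => ∇ ψ y) z with hX
  set C1 : ℝ := ‖X‖ / 2 + 1 with hC1
  have hC1' : 0 ≤ C1 := by positivity
  -- The second summand serves points within the Taylor radius, the third those outside it; the `1`
  -- only ensures `1 ≤ C₀`.
  refine ⟨1 + 2 / P * (|σ| + C1) + 6 / R, by
    have : 0 ≤ 2 / P * (|σ| + C1) := by positivity
    have : 0 ≤ 6 / R := by positivity
    linarith, ?_⟩
  have hev1 : ∀ᶠ p : E × ℝ in 𝓝 z ×ˢ 𝓝[>] 0, (P / 2 ≤ inner ℝ (∇ ψ p.1) n ∧ ‖∇ ψ p.1‖ ≤ 2 * P) ∧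
      p.1 ∈ Metric.ball z R := by
    have h1 := (eventually_gradient_bounds hψ hz).and (Metric.ball_mem_nhds z hR)
    rw [← hn] at h1
    exact h1.prod_inl _
  have hev2 : ∀ᶠ p : E × ℝ in 𝓝 z ×ˢ 𝓝[>] 0, 0 < p.2 :=
    (eventually_mem_nhdsWithin (s := Set.Ioi (0 : ℝ)) (a := 0)).prod_inr _
  filter_upwards [hev1, hev2] with p ⟨⟨hq, hgn⟩, hxR⟩ hh w τ hne
  set x := p.1
  set h := p.2
  set g := ∇ ψ x with hg
  set y := shearedPoint g n (√h) w τ with hy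
  have hs : 0 < √h := Real.sqrt_pos.2 hh
  have hs2 : √h * √h = h := Real.mul_self_sqrt hh.le
  set q := inner ℝ g n with hqdef
  have hq0 : 0 < q := by linarith
  have hgy : inner ℝ g y = √h * τ * q := inner_shearedPoint hq0.ne' _ _ _
  have hyn : 0 ≤ ‖y‖ := norm_nonneg _
  have h1y : 1 ≤ (1 + ‖y‖) ^ 2 := one_le_pow₀ (by linarith)
  have h2y : ‖y‖ ^ 2 ≤ (1 + ‖y‖) ^ 2 := by gcongr; linarith
  have hfin : ∀ A : ℝ, A ≤ 1 + 2 / P * (|σ| + C1) + 6 / R → |τ| ≤ A * (1 + ‖y‖) ^ 2 →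
      |τ| ≤ (1 + 2 / P * (|σ| + C1) + 6 / R) * (1 + ‖y‖) ^ 2 := fun A hA h => h.trans (by gcongr)
  rcases le_or_gt ‖√h • y‖ R with hv | hv
  · refine hfin (2 / P * (|σ| + C1)) (by have : 0 < 6 / R := by positivity
                                         linarith) ?_
    have h1 := hT x hxR (√h • y) hv
    have h2 : |inner ℝ (X (√h • y)) (√h • y)| ≤ ‖X‖ * (h * ‖y‖ ^ 2) := by
      refine (abs_real_inner_le_norm _ _).trans ?_
      have := X.le_opNorm (√h • y)
      calc _ ≤ ‖X‖ * ‖√h • y‖ * ‖√h • y‖ := by gcongr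
        _ = ‖X‖ * ((√h * √h) * ‖y‖ ^ 2) := by
          rw [norm_smul, Real.norm_of_nonneg hs.le]; ring
        _ = _ := by rw [hs2]
    have h3 : ‖√h • y‖ ^ 2 = h * ‖y‖ ^ 2 := by
      rw [norm_smul, Real.norm_of_nonneg hs.le, mul_pow, Real.sq_sqrt hh.le]
    have h4 : inner ℝ g (√h • y) = h * (τ * q) := by
      rw [real_inner_smul_right, hgy]; linear_combination (τ * q) * hs2
    rw [h3, h4] at h1
    have h5 : |ψ (x - √h • y) - ψ x + h * (τ * q)| ≤ h * (C1 * ‖y‖ ^ 2) := by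
      rw [abs_le] at h1 h2 ⊢
      rw [hC1]
      constructor <;> nlinarith
    rw [abs_le] at h5
    have hσ := abs_le.1 (le_refl |σ|)
    have h6 : |τ| * q ≤ |σ| + C1 * ‖y‖ ^ 2 := by
      -- The only two ways in which the indicators can differ; in each, Taylor's formula bounds `|τ|
      -- q`.
      have hcase : (0 < τ ∧ ψ x + σ * h ≤ ψ (x - √h • y)) ∨
          (τ ≤ 0 ∧ ψ (x - √h • y) < ψ x + σ * h) := by
        by_contra hcon
        apply hne
        have h7 : inner ℝ g y ≤ 0 ↔ τ ≤ 0 := by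
          rw [hgy]
          constructor
          · intro h8
            by_contra h9
            have : 0 < √h * τ * q := by have := not_le.1 h9; positivity
            linarith
          · intro h8
            exact mul_nonpos_of_nonpos_of_nonneg (mul_nonpos_of_nonneg_of_nonpos hs.le h8) hq0.le
        change K y * ((if ψ x + σ * h ≤ ψ (x - √h • y) then 1 else 0) -
          (if inner ℝ g y ≤ 0 then 1 else 0)) = 0
        simp only [h7]
        push Not at hcon
        rcases le_or_gt τ 0 with ht | ht
        · simp [ht, hcon.2 ht]
        · simp [not_le.2 ht, not_le.2 (hcon.1 ht)]
      rcases hcase with ⟨ht, hA⟩ | ⟨ht, hA⟩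
      · rw [abs_of_pos ht]
        refine le_of_mul_le_mul_left ?_ hh
        nlinarith [h5.2, mul_le_mul_of_nonneg_left hσ.1 hh.le]
      · rw [abs_of_nonpos ht]
        refine le_of_mul_le_mul_left ?_ hh
        nlinarith [h5.1, mul_le_mul_of_nonneg_left hσ.2 hh.le]
    have h7 : |τ| * (P / 2) ≤ (|σ| + C1) * (1 + ‖y‖) ^ 2 := by
      calc |τ| * (P / 2) ≤ |τ| * q := by gcongr
        _ ≤ |σ| * 1 + C1 * ‖y‖ ^ 2 := by linarith
        _ ≤ |σ| * (1 + ‖y‖) ^ 2 + C1 * (1 + ‖y‖) ^ 2 := by gcongr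
        _ = _ := by ring
    rw [← le_div_iff₀ (by positivity)] at h7
    refine h7.trans (le_of_eq ?_)
    field_simp
  -- Beyond the Taylor radius only geometry is used: the shear contributes `4‖y‖` and the height
  -- `2‖y‖`, so `√h |τ| ≤ 6‖y‖`. Multiplying by `‖y‖` and using `√h ‖y‖ > R` gives the quadratic
  -- bound.
  · refine hfin (6 / R) (by have : 0 ≤ 2 / P * (|σ| + C1) := by positivity
                            linarith) ?_
    have hw : ‖(w : E)‖ ≤ ‖y‖ := norm_le_norm_add_smul n w _
    set r : ℝ := inner ℝ g (w : E) / q with hr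
    have hr1 : |r| ≤ 4 * ‖y‖ := by
      rw [hr, abs_div, abs_of_pos hq0, div_le_iff₀ hq0]
      calc |inner ℝ g (w : E)| ≤ ‖g‖ * ‖(w : E)‖ := abs_real_inner_le_norm _ _
        _ ≤ (2 * P) * ‖y‖ := by gcongr
        _ ≤ 4 * ‖y‖ * q := by nlinarith
    have h1 : |(-r + √h * τ)| ≤ 2 * ‖y‖ := by
      have h2 : y - (w : E) = (-r + √h * τ) • n := by
        rw [hy, shearedPoint]; simp [hr, hqdef]
      have h3 := norm_sub_le y (w : E)
      rw [h2, norm_smul, hn1, mul_one, Real.norm_eq_abs] at h3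
      linarith
    have h2 : √h * |τ| ≤ 6 * ‖y‖ := by
      have h3 : √h * |τ| = |r + (-r + √h * τ)| := by
        rw [add_neg_cancel_left, abs_mul, abs_of_pos hs]
      rw [h3]
      linarith [abs_add_le r (-r + √h * τ)]
    rw [norm_smul, Real.norm_of_nonneg hs.le] at hv
    rw [div_mul_eq_mul_div, le_div_iff₀ hR]
    calc |τ| * R ≤ |τ| * (√h * ‖y‖) := by gcongr
      _ = (√h * |τ|) * ‖y‖ := by ring
      _ ≤ 6 * ‖y‖ * ‖y‖ := by gcongr
      _ = 6 * ‖y‖ ^ 2 := by ring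
      _ ≤ _ := by gcongr

omit [MeasurableSpace E] [BorelSpace E] in
/-- The sheared points converge to their hyperplane component. -/
theorem tendsto_shearedPoint (hψ : ContDiff ℝ 2 ψ) {z : E} (hz : ∇ ψ z ≠ 0) {n : E}
    (hn : n = ‖∇ ψ z‖⁻¹ • ∇ ψ z) (w : (Submodule.span ℝ {n})ᗮ) (τ : ℝ) :
    Tendsto (fun p : E × ℝ => shearedPoint (∇ ψ p.1) n (√p.2) w τ) (𝓝 z ×ˢ 𝓝[>] 0) (𝓝 (w : E)) := by
  have hg := (contDiff_gradient hψ).continuous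
  have hz' : 0 < ‖∇ ψ z‖ := norm_pos_iff.2 hz
  have hle : 𝓝 z ×ˢ 𝓝[>] (0 : ℝ) ≤ 𝓝 (z, (0 : ℝ)) := by
    rw [nhds_prod_eq]
    exact prod_mono le_rfl nhdsWithin_le_nhds
  have hzn : ∇ ψ z = ‖∇ ψ z‖ • n := by
    rw [hn, smul_smul, mul_inv_cancel₀ hz'.ne', one_smul]
  have h1 : inner ℝ (∇ ψ z) (w : E) = 0 := by
    rw [hzn, real_inner_smul_left, Submodule.inner_right_of_mem_orthogonal
      (Submodule.mem_span_singleton_self n) w.2, mul_zero]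
  have h2 : inner ℝ (∇ ψ z) n ≠ 0 := by
    rw [hn, real_inner_smul_right, real_inner_self_eq_norm_sq]
    positivity
  have h3 : ContinuousAt (fun p : E × ℝ => shearedPoint (∇ ψ p.1) n (√p.2) w τ) (z, 0) := by
    unfold shearedPoint
    have h4 : ContinuousAt (fun p : E × ℝ => inner ℝ (∇ ψ p.1) (w : E) / inner ℝ (∇ ψ p.1) n)
        (z, 0) := ContinuousAt.div (by fun_prop) (by fun_prop) h2
    fun_prop
  have h5 := h3.tendsto.mono_left hle
  simpa [shearedPoint, h1] using h5

omit [MeasurableSpace E] [BorelSpace E] in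
/-- The rescaled increments of `ψ` along the sheared points. -/
theorem tendsto_increment (hψ : ContDiff ℝ 2 ψ) {z : E} (hz : ∇ ψ z ≠ 0) {n : E}
    (hn : n = ‖∇ ψ z‖⁻¹ • ∇ ψ z) (w : (Submodule.span ℝ {n})ᗮ) (τ : ℝ) :
    Tendsto (fun p : E × ℝ =>
      (ψ (p.1 - √p.2 • shearedPoint (∇ ψ p.1) n (√p.2) w τ) - ψ p.1) / p.2) (𝓝 z ×ˢ 𝓝[>] 0)
      (𝓝 (-(τ * ‖∇ ψ z‖) + 1 / 2 *
        inner ℝ (fderiv ℝ (fun y => ∇ ψ y) z (w : E)) (w : E))) := by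
  have hg := (contDiff_gradient hψ).continuous
  have hz' : 0 < ‖∇ ψ z‖ := norm_pos_iff.2 hz
  set X := fderiv ℝ (fun y => ∇ ψ y) z with hX
  set Y : E × ℝ → E := fun p => shearedPoint (∇ ψ p.1) n (√p.2) w τ with hY
  have hYt : Tendsto Y (𝓝 z ×ˢ 𝓝[>] 0) (𝓝 (w : E)) := tendsto_shearedPoint hψ hz hn w τ
  have hq : inner ℝ (∇ ψ z) n = ‖∇ ψ z‖ := by
    rw [hn, real_inner_smul_right, real_inner_self_eq_norm_sq]; field_simp
  have hmain : Tendsto (fun p : E × ℝ => -(τ * inner ℝ (∇ ψ p.1) n) +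
      1 / 2 * inner ℝ (X (Y p)) (Y p)) (𝓝 z ×ˢ 𝓝[>] 0)
      (𝓝 (-(τ * ‖∇ ψ z‖) + 1 / 2 * inner ℝ (X (w : E)) (w : E))) := by
    have h1 : Tendsto (fun p : E × ℝ => inner ℝ (∇ ψ p.1) n) (𝓝 z ×ˢ 𝓝[>] 0)
        (𝓝 ‖∇ ψ z‖) := by
      rw [← hq]
      have : Continuous fun x : E => inner ℝ (∇ ψ x) n := by fun_prop
      exact (this.tendsto z).comp tendsto_fst
    have h2 : Continuous fun y : E => inner ℝ (X y) y := by fun_prop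
    exact ((h1.const_mul τ).neg).add (((h2.tendsto _).comp hYt).const_mul _)
  refine hmain.congr_dist (Metric.tendsto_nhds.2 fun ε hε => ?_)
  set M : ℝ := ‖(w : E)‖ + 1 with hM
  have hM0 : 0 < M := by positivity
  obtain ⟨R, hR, hT⟩ := exists_taylor_bound hψ z (η := ε / (2 * M ^ 2)) (by positivity)
  have hev1 : ∀ᶠ p : E × ℝ in 𝓝 z ×ˢ 𝓝[>] 0,
      ‖∇ ψ z‖ / 2 ≤ inner ℝ (∇ ψ p.1) n ∧ p.1 ∈ Metric.ball z R := by
    have h1 := (eventually_gradient_bounds hψ hz).and (Metric.ball_mem_nhds z hR)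
    rw [← hn] at h1
    filter_upwards [h1.prod_inl (𝓝[>] (0 : ℝ))] with p hp using ⟨hp.1.1, hp.2⟩
  have hev2 : ∀ᶠ p : E × ℝ in 𝓝 z ×ˢ 𝓝[>] 0, 0 < p.2 :=
    (eventually_mem_nhdsWithin (s := Set.Ioi (0 : ℝ)) (a := 0)).prod_inr _
  have hev3 : ∀ᶠ p in 𝓝 z ×ˢ 𝓝[>] 0, ‖Y p‖ ≤ M :=
    hYt.norm.eventually_le_const (by rw [hM]; linarith)
  have hev4 : ∀ᶠ p : E × ℝ in 𝓝 z ×ˢ 𝓝[>] 0, ‖√p.2 • Y p‖ ≤ R := by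
    have h1 : Tendsto (fun p : E × ℝ => √p.2) (𝓝 z ×ˢ 𝓝[>] 0) (𝓝 0) := by
      have := (Real.continuous_sqrt.tendsto 0).comp
        ((tendsto_snd (f := 𝓝 z) (g := 𝓝[>] (0 : ℝ))).mono_right nhdsWithin_le_nhds)
      simpa [Function.comp_def] using this
    have h2 := (h1.smul hYt).norm
    rw [zero_smul, norm_zero] at h2
    exact h2.eventually_le_const hR
  filter_upwards [hev1, hev2, hev3, hev4] with p ⟨hp1, hp2⟩ hh hp3 hp4
  have h1 := hT p.1 hp2 _ hp4
  have hs2 : √p.2 * √p.2 = p.2 := Real.mul_self_sqrt hh.le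
  have h2 : inner ℝ (∇ ψ p.1) (√p.2 • Y p) = p.2 * (τ * inner ℝ (∇ ψ p.1) n) := by
    rw [real_inner_smul_right, hY, inner_shearedPoint (by linarith)]
    linear_combination (τ * inner ℝ (∇ ψ p.1) n) * hs2
  have h3 : inner ℝ (X (√p.2 • Y p)) (√p.2 • Y p) = p.2 * inner ℝ (X (Y p)) (Y p) := by
    rw [map_smul, real_inner_smul_left, real_inner_smul_right, ← mul_assoc, hs2]
  have h4 : ‖√p.2 • Y p‖ ^ 2 = p.2 * ‖Y p‖ ^ 2 := by
    rw [norm_smul, Real.norm_of_nonneg (Real.sqrt_nonneg _), mul_pow, Real.sq_sqrt hh.le]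
  rw [h2, ← hX, h3, h4] at h1
  rw [Real.dist_eq, Real.dist_eq, sub_zero, abs_abs, abs_sub_comm]
  have h5 : (ψ (p.1 - √p.2 • Y p) - ψ p.1) / p.2 -
      (-(τ * inner ℝ (∇ ψ p.1) n) + 1 / 2 * inner ℝ (X (Y p)) (Y p)) =
      (ψ (p.1 - √p.2 • Y p) - ψ p.1 + p.2 * (τ * inner ℝ (∇ ψ p.1) n) -
        1 / 2 * (p.2 * inner ℝ (X (Y p)) (Y p))) / p.2 := by
    field_simp
    ring
  rw [h5, abs_div, abs_of_pos hh, div_lt_iff₀ hh]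
  refine h1.trans_lt ?_
  calc ε / (2 * M ^ 2) * (p.2 * ‖Y p‖ ^ 2) ≤ ε / (2 * M ^ 2) * (p.2 * M ^ 2) := by gcongr
    _ = ε / 2 * p.2 := by field_simp
    _ < ε * p.2 := by gcongr; linarith

/-- Off the limiting interface the limit of the rescaled increment differs from `σ`, so the
superlevel indicator is eventually constant. In sheared coordinates the half-space is eventually
exactly `{τ ≤ 0}`. -/
theorem tendsto_levelDiff (hK : IsConsistentKernel K) (hψ : ContDiff ℝ 2 ψ) {z : E}
    (hz : ∇ ψ z ≠ 0) (σ : ℝ) {n : E} (hn : n = ‖∇ ψ z‖⁻¹ • ∇ ψ z)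
    (w : (Submodule.span ℝ {n})ᗮ) {τ : ℝ}
    (hτ : τ ≠ (1 / 2 * inner ℝ (fderiv ℝ (fun y => ∇ ψ y) z (w : E)) (w : E) - σ) / ‖∇ ψ z‖) :
    Tendsto (fun p : E × ℝ => levelDiff K ψ σ p.1 p.2 (shearedPoint (∇ ψ p.1) n (√p.2) w τ))
      (𝓝 z ×ˢ 𝓝[>] 0) (𝓝 (K w * ((if τ ≤ (1 / 2 * inner ℝ (fderiv ℝ (fun y => ∇ ψ y) z (w : E))
        (w : E) - σ) / ‖∇ ψ z‖ then 1 else 0) - (if τ ≤ 0 then 1 else 0)))) := by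
  have hz' : 0 < ‖∇ ψ z‖ := norm_pos_iff.2 hz
  have hinc := tendsto_increment hψ hz hn w τ
  have hY := tendsto_shearedPoint hψ hz hn w τ
  have hKt := (hK.continuous.tendsto (w : E)).comp hY
  set Q := inner ℝ (fderiv ℝ (fun y => ∇ ψ y) z (w : E)) (w : E) with hQ
  have hev1 : ∀ᶠ p : E × ℝ in 𝓝 z ×ˢ 𝓝[>] 0, ‖∇ ψ z‖ / 2 ≤ inner ℝ (∇ ψ p.1) n := by
    have h1 := eventually_gradient_bounds hψ hz
    rw [← hn] at h1
    filter_upwards [h1.prod_inl (𝓝[>] (0 : ℝ))] with p hp using hp.1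
  have hev2 : ∀ᶠ p : E × ℝ in 𝓝 z ×ˢ 𝓝[>] 0, 0 < p.2 :=
    (eventually_mem_nhdsWithin (s := Set.Ioi (0 : ℝ)) (a := 0)).prod_inr _
  have hev3 : ∀ᶠ p : E × ℝ in 𝓝 z ×ˢ 𝓝[>] 0,
      (σ ≤ (ψ (p.1 - √p.2 • shearedPoint (∇ ψ p.1) n (√p.2) w τ) - ψ p.1) / p.2 ↔
        τ ≤ (1 / 2 * Q - σ) / ‖∇ ψ z‖) := by
    rcases lt_or_gt_of_ne hτ with h | h
    · have h' := h
      rw [lt_div_iff₀ hz'] at h'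
      filter_upwards [hinc.eventually_const_le (by linarith : σ < -(τ * ‖∇ ψ z‖) + 1 / 2 * Q)]
        with p hp
      exact iff_of_true hp h.le
    · have h' := h
      rw [div_lt_iff₀ hz'] at h'
      filter_upwards [hinc.eventually_lt_const (by linarith : -(τ * ‖∇ ψ z‖) + 1 / 2 * Q < σ)]
        with p hp
      exact iff_of_false (not_le.2 hp) (not_le.2 h)
  refine (hKt.mul_const ((if τ ≤ (1 / 2 * Q - σ) / ‖∇ ψ z‖ then (1 : ℝ) else 0) -
    (if τ ≤ 0 then 1 else 0))).congr' ?_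
  filter_upwards [hev1, hev2, hev3] with p hq hh hiff
  have hs : 0 < √p.2 := Real.sqrt_pos.2 hh
  have hq0 : 0 < inner ℝ (∇ ψ p.1) n := by linarith
  have h1 : ψ p.1 + σ * p.2 ≤ ψ (p.1 - √p.2 • shearedPoint (∇ ψ p.1) n (√p.2) w τ) ↔
      τ ≤ (1 / 2 * Q - σ) / ‖∇ ψ z‖ := by
    rw [← hiff, le_div_iff₀ hh]
    constructor <;> intro <;> linarith
  have h2 : inner ℝ (∇ ψ p.1) (shearedPoint (∇ ψ p.1) n (√p.2) (w : E) τ) ≤ 0 ↔ τ ≤ 0 := by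
    rw [inner_shearedPoint hq0.ne', mul_right_comm]
    simpa using (mul_pos_iff_of_pos_left (mul_pos hs hq0) (b := τ)).not
  simp only [levelDiff, h1, h2, Function.comp_apply]

/-- The first order expansion of the nonlocal average of a superlevel set. -/
theorem tendsto_levelValue (hK : IsConsistentKernel K) (hψ : ContDiff ℝ 2 ψ) {z : E}
    (hz : ∇ ψ z ≠ 0) (σ : ℝ) {n : E} (hn : n = ‖∇ ψ z‖⁻¹ • ∇ ψ z) :
    Tendsto (fun p : E × ℝ => ((∫ y, K y *
      Set.indicator {y | ψ p.1 + σ * p.2 ≤ ψ y} (fun _ => 1) (p.1 - √p.2 • y)) - 1 / 2) / √p.2)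
      (𝓝 z ×ˢ 𝓝[>] 0) (𝓝 (∫ w : (Submodule.span ℝ {n})ᗮ, K w *
        ((1 / 2 * inner ℝ (fderiv ℝ (fun y => ∇ ψ y) z (w : E)) (w : E) - σ) / ‖∇ ψ z‖))) := by
  have hz' : 0 < ‖∇ ψ z‖ := norm_pos_iff.2 hz
  have hn1 : ‖n‖ = 1 := by rw [hn, norm_smul, norm_inv, norm_norm, inv_mul_cancel₀ hz'.ne']
  have hfr := finrank_hyperplane n hn1
  have hd : 1 ≤ Module.finrank ℝ E := by
    have : Nontrivial E := ⟨∇ ψ z, 0, hz⟩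
    exact Module.finrank_pos
  set X := fderiv ℝ (fun y => ∇ ψ y) z with hX
  set T : (Submodule.span ℝ {n})ᗮ → ℝ :=
    fun w => (1 / 2 * inner ℝ (X (w : E)) (w : E) - σ) / ‖∇ ψ z‖ with hTdef
  have hTc : Continuous T := by fun_prop
  have hKc := hK.continuous
  have hψc := hψ.continuous
  set L : (Submodule.span ℝ {n})ᗮ × ℝ → ℝ := fun a =>
    K a.1 * ((if a.2 ≤ T a.1 then 1 else 0) - (if a.2 ≤ 0 then 1 else 0)) with hL
  set D : E × ℝ → (Submodule.span ℝ {n})ᗮ × ℝ → ℝ := fun p a =>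
    levelDiff K ψ σ p.1 p.2 (shearedPoint (∇ ψ p.1) n (√p.2) a.1 a.2) with hD
  have hDm : ∀ p, Measurable (D p) := by
    intro p
    refine (measurable_levelDiff hK hψ σ p.1 p.2).comp ?_
    unfold shearedPoint
    fun_prop
  have hLm : Measurable L := by
    refine Measurable.mul (Continuous.measurable (by fun_prop)) (Measurable.sub ?_ ?_)
    · exact Measurable.ite (measurableSet_le (by fun_prop) (by fun_prop)) measurable_const
        measurable_const
    · exact Measurable.ite (measurableSet_le (by fun_prop) (by fun_prop)) measurable_const
        measurable_const
  have habs : ∀ (P Q : Prop) [Decidable P] [Decidable Q],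
      |(if P then (1 : ℝ) else 0) - (if Q then 1 else 0)| ≤ 1 := by
    intro P Q _ _
    split_ifs <;> simp
  have hite : ∀ (y : E) (P Q : Prop) [Decidable P] [Decidable Q],
      ‖K y * ((if P then (1 : ℝ) else 0) - (if Q then 1 else 0))‖ ≤ |K y| := by
    intro y P Q _ _
    rw [norm_mul, Real.norm_eq_abs, Real.norm_eq_abs]
    exact mul_le_of_le_one_right (abs_nonneg _) (habs P Q)
  obtain ⟨C₀, hC₀, hquad⟩ := exists_abs_le_of_levelDiff_ne_zero (K := K) hψ hz σ hn
  obtain ⟨C, hC, hbound⟩ := hK.exists_parabolic_bound hd hC₀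
  have hDb : ∀ᶠ p in 𝓝 z ×ˢ 𝓝[>] (0 : ℝ), ∀ a, ‖D p a‖ ≤
      C * ((1 + ‖a.1‖) ^ (-((Module.finrank ℝ E : ℝ) - 1 / 2)) *
        (1 + ‖a.2‖) ^ (-(5 / 4 : ℝ))) := by
    filter_upwards [hquad] with p hp a
    by_cases h0 : D p a = 0
    · rw [h0, norm_zero]; positivity
    · exact (hite _ _ _).trans
        (hbound _ _ _ (norm_nonneg _) (norm_le_norm_add_smul n a.1 _) (hp a.1 a.2 h0))
  set C₁ : ℝ := 1 + (‖X‖ + |σ|) / ‖∇ ψ z‖ with hC₁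
  obtain ⟨C', hC', hbound'⟩ := hK.exists_parabolic_bound hd (C₀ := C₁)
    (by rw [hC₁]; have : 0 ≤ (‖X‖ + |σ|) / ‖∇ ψ z‖ := by positivity
        linarith)
  have hTb : ∀ w, |T w| ≤ C₁ * (1 + ‖(w : E)‖) ^ 2 := by
    intro w
    have h1 : |inner ℝ (X (w : E)) (w : E)| ≤ ‖X‖ * ‖(w : E)‖ ^ 2 := by
      refine (abs_real_inner_le_norm _ _).trans ?_
      have := X.le_opNorm (w : E)
      calc _ ≤ ‖X‖ * ‖(w : E)‖ * ‖(w : E)‖ := by gcongr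
        _ = _ := by ring
    have hw : 0 ≤ ‖(w : E)‖ := norm_nonneg _
    have h2 : |1 / 2 * inner ℝ (X (w : E)) (w : E) - σ| ≤
        (‖X‖ + |σ|) * (1 + ‖(w : E)‖) ^ 2 := by
      refine (abs_sub _ _).trans ?_
      rw [abs_mul, abs_of_pos (by norm_num : (0 : ℝ) < 1 / 2)]
      have h3 : ‖X‖ * ‖(w : E)‖ ^ 2 ≤ ‖X‖ * (1 + ‖(w : E)‖) ^ 2 := by gcongr; linarith
      have h4 : |σ| * 1 ≤ |σ| * (1 + ‖(w : E)‖) ^ 2 := by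
        gcongr; exact one_le_pow₀ (by linarith)
      nlinarith [abs_nonneg (inner ℝ (X (w : E)) (w : E))]
    rw [hTdef]
    simp only
    rw [abs_div, abs_norm, div_le_iff₀ hz', hC₁]
    refine h2.trans ?_
    have h5 : (1 + (‖X‖ + |σ|) / ‖∇ ψ z‖) * (1 + ‖(w : E)‖) ^ 2 * ‖∇ ψ z‖ =
        ‖∇ ψ z‖ * (1 + ‖(w : E)‖) ^ 2 + (‖X‖ + |σ|) * (1 + ‖(w : E)‖) ^ 2 := by
      field_simp
    rw [h5]
    have : 0 ≤ ‖∇ ψ z‖ * (1 + ‖(w : E)‖) ^ 2 := by positivity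
    linarith
  have hLint : Integrable L (volume.prod volume) := by
    refine (integrable_parabolic_bound n hn1 C').mono' hLm.aestronglyMeasurable
      (Eventually.of_forall fun a => ?_)
    -- The limit integrand vanishes when `|τ| > |T w|`; since `T` grows at most quadratically, the
    -- parabolic majorant applies to it as well.
    by_cases h0 : |a.2| ≤ |T a.1|
    · exact (hite _ _ _).trans (hbound' _ _ _ (norm_nonneg _) le_rfl (h0.trans (hTb a.1)))
    · have h1 : L a = 0 := by
        have h2 : (a.2 ≤ T a.1) ↔ (a.2 ≤ 0) := by
          rcases le_total a.2 0 with h | h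
          · refine iff_of_true ?_ h
            rw [abs_of_nonpos h] at h0
            linarith [neg_abs_le (T a.1), not_le.1 h0]
          · rw [abs_of_nonneg h] at h0
            have h3 := not_le.1 h0
            refine iff_of_false (not_le.2 ((le_abs_self _).trans_lt h3))
              (not_le.2 ((abs_nonneg _).trans_lt h3))
        simp only [hL, h2, sub_self, mul_zero]
      rw [h1, norm_zero]; positivity
  have hae : ∀ᵐ a ∂(volume.prod volume : Measure ((Submodule.span ℝ {n})ᗮ × ℝ)),
      Tendsto (fun p => D p a) (𝓝 z ×ˢ 𝓝[>] 0) (𝓝 (L a)) := by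
    -- The exceptional set is the graph of `T`, which meets each vertical line in a single point.
    have h1 : ∀ᵐ a ∂(volume.prod volume : Measure ((Submodule.span ℝ {n})ᗮ × ℝ)), a.2 ≠ T a.1 := by
      rw [Measure.ae_prod_iff_ae_ae]
      · refine Eventually.of_forall fun w => ?_
        simp [ae_iff]
      · exact (measurableSet_eq_fun (by fun_prop) (by fun_prop)).compl
    filter_upwards [h1] with a ha
    exact tendsto_levelDiff hK hψ hz σ hn a.1 ha
  have hlim := tendsto_integral_filter_of_dominated_convergence
    (fun a : (Submodule.span ℝ {n})ᗮ × ℝ =>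
      C * ((1 + ‖a.1‖) ^ (-((Module.finrank ℝ E : ℝ) - 1 / 2)) * (1 + ‖a.2‖) ^ (-(5 / 4 : ℝ))))
    (Eventually.of_forall fun p => (hDm p).aestronglyMeasurable)
    (hDb.mono fun p hp => Eventually.of_forall hp) (integrable_parabolic_bound n hn1 C) hae
  have hLval : ∫ a, L a ∂(volume.prod volume) = ∫ w : (Submodule.span ℝ {n})ᗮ, K w * T w := by
    rw [integral_prod _ hLint]
    refine integral_congr_ae (Eventually.of_forall fun w => ?_)
    simp only [hL]
    rw [integral_const_mul, integral_ite_sub_ite]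
  rw [hLval] at hlim
  refine hlim.congr' ?_
  have hev1 : ∀ᶠ p : E × ℝ in 𝓝 z ×ˢ 𝓝[>] 0, ‖∇ ψ z‖ / 2 ≤ inner ℝ (∇ ψ p.1) n := by
    have h1 := eventually_gradient_bounds hψ hz
    rw [← hn] at h1
    filter_upwards [h1.prod_inl (𝓝[>] (0 : ℝ))] with p hp using hp.1
  have hev2 : ∀ᶠ p : E × ℝ in 𝓝 z ×ˢ 𝓝[>] 0, 0 < p.2 :=
    (eventually_mem_nhdsWithin (s := Set.Ioi (0 : ℝ)) (a := 0)).prod_inr _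
  filter_upwards [hev1, hev2, hDb] with p hq hh hb
  have hs : 0 < √p.2 := Real.sqrt_pos.2 hh
  have hgp : ∇ ψ p.1 ≠ 0 := by
    intro h0
    rw [h0, inner_zero_left] at hq
    linarith
  -- The Jacobian `√h` of the sheared coordinates cancels the division by `√h`.
  rw [← integral_levelDiff hK hψ σ hgp, integral_eq_integral_shearedPoint (∇ ψ p.1) n hn1 hs
    (integrable_levelDiff hK hψ σ p.1 p.2), mul_div_cancel_left₀ _ hs.ne', integral_prod]
  exact (integrable_parabolic_bound n hn1 C).mono' (hDm p).aestronglyMeasurable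
    (Eventually.of_forall hb)

end Asymptotics

/-! ### Identification of the limit with the Hamiltonian -/

section Consistency

open Filter Topology

variable {d : ℕ} {φ ψ : EuclideanSpace ℝ (Fin d) → ℝ}

/-- The first order coefficient of the level value is affine in the speed `σ`. -/
theorem IsConsistentKernel.integral_hyperplane_affine {E : Type} [NormedAddCommGroup E]
    [InnerProductSpace ℝ E] [FiniteDimensional ℝ E] [MeasurableSpace E] [BorelSpace E] {K : E → ℝ}
    (hK : IsConsistentKernel K) {n : E} (hn : ‖n‖ = 1) (X : E →L[ℝ] E) (σ P : ℝ) :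
    ∫ w : (Submodule.span ℝ {n})ᗮ, K w * ((1 / 2 * inner ℝ (X (w : E)) (w : E) - σ) / P) =
      ((1 / 2) * (∫ w : (Submodule.span ℝ {n})ᗮ, inner ℝ (X (w : E)) (w : E) * K w) -
        σ * ∫ w : (Submodule.span ℝ {n})ᗮ, K w) / P := by
  have hKc := hK.continuous
  obtain ⟨C, hC0, hC⟩ := hK.decay
  have hfr := finrank_hyperplane n hn
  have h1 : Integrable fun w : (Submodule.span ℝ {n})ᗮ => K w := by
    refine ((integrable_one_add_norm (r := (Module.finrank ℝ E : ℝ) + 2)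
      (by linarith)).const_mul C).mono' (Continuous.aestronglyMeasurable (by fun_prop))
      (Eventually.of_forall fun w => hC w)
  -- The quadratic factor costs two powers of decay; the remaining exponent `d` still exceeds the
  -- hyperplane dimension `d - 1`.
  have h2 : Integrable fun w : (Submodule.span ℝ {n})ᗮ => inner ℝ (X (w : E)) (w : E) * K w := by
    refine ((integrable_one_add_norm (r := (Module.finrank ℝ E : ℝ))
      (by linarith)).const_mul (‖X‖ * C)).mono' (Continuous.aestronglyMeasurable (by fun_prop))
      (Eventually.of_forall fun w => ?_)
    rw [norm_mul, Real.norm_eq_abs, Real.norm_eq_abs]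
    have h3 : |inner ℝ (X (w : E)) (w : E)| ≤ ‖X‖ * (1 + ‖(w : E)‖) ^ 2 := by
      refine (abs_real_inner_le_norm _ _).trans ?_
      have := X.le_opNorm (w : E)
      calc _ ≤ ‖X‖ * ‖(w : E)‖ * ‖(w : E)‖ := by gcongr
        _ = ‖X‖ * ‖(w : E)‖ ^ 2 := by ring
        _ ≤ _ := by gcongr; linarith
    have h4 : (1 + ‖(w : E)‖) ^ (-((Module.finrank ℝ E : ℝ) + 2)) * (1 + ‖(w : E)‖) ^ 2 =
        (1 + ‖w‖) ^ (-(Module.finrank ℝ E : ℝ)) := by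
      rw [← Real.rpow_natCast, ← Real.rpow_add (by positivity)]
      push_cast
      congr 1
      ring
    calc _ ≤ ‖X‖ * (1 + ‖(w : E)‖) ^ 2 *
          (C * (1 + ‖(w : E)‖) ^ (-((Module.finrank ℝ E : ℝ) + 2))) := by
          gcongr
          exact hC w
      _ = _ := by rw [← h4]; ring
  rw [← integral_const_mul, ← integral_const_mul, ← integral_sub (h2.const_mul _) (h1.const_mul _),
    ← integral_div]
  refine integral_congr_ae (Eventually.of_forall fun w => ?_)
  simp only
  ring

theorem span_singleton_inv_norm_smul {E : Type*} [NormedAddCommGroup E] [NormedSpace ℝ E] {p : E}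
    (hp : p ≠ 0) : Submodule.span ℝ {‖p‖⁻¹ • p} = Submodule.span ℝ {p} :=
  Submodule.span_singleton_smul_eq (IsUnit.mk0 _ (inv_ne_zero (norm_ne_zero_iff.2 hp))) p

/-- The level value at speed `-F + e` deviates from `1 / 2` by `-c - e I` at first order, where `I`
is positive. -/
theorem exists_tendsto_levelValue (hφ : IsFinslerMetric φ)
    (hdual : ContDiffOn ℝ ∞ (dualMetric φ) {0}ᶜ) (c : ℝ) (hψ : ContDiff ℝ 2 ψ)
    {z : EuclideanSpace ℝ (Fin d)} (hz : ∇ ψ z ≠ 0) :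
    ∃ I : ℝ, 0 < I ∧ ∀ e : ℝ, Tendsto (fun p : EuclideanSpace ℝ (Fin d) × ℝ =>
      (levelValue φ p.2 ψ (ψ p.1 + (-F φ c (hessian ψ z) (∇ ψ z) + e) * p.2) p.1 - 1 / 2) / √p.2)
      (𝓝 z ×ˢ 𝓝[>] 0) (𝓝 (-c - e * I)) := by
  have hK := hφ.isConsistentKernel hdual
  have hz' : 0 < ‖∇ ψ z‖ := norm_pos_iff.2 hz
  have hn1 : ‖‖∇ ψ z‖⁻¹ • ∇ ψ z‖ = 1 := by
    rw [norm_smul, norm_inv, norm_norm, inv_mul_cancel₀ hz'.ne']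
  have hspan := span_singleton_inv_norm_smul hz
  have hpos := hK.hyperplane_pos _ hn1
  rw [hspan] at hpos
  refine ⟨(∫ w : ((Submodule.span ℝ {∇ ψ z})ᗮ : Submodule ℝ (EuclideanSpace ℝ (Fin d))),
    kernel φ 1 (w : EuclideanSpace ℝ (Fin d))) / ‖∇ ψ z‖, by positivity, fun e => ?_⟩
  have h1 := tendsto_levelValue hK hψ hz (-F φ c (hessian ψ z) (∇ ψ z) + e) rfl
  rw [hK.integral_hyperplane_affine hn1, hspan] at h1
  have h2 : ∀ᶠ p : EuclideanSpace ℝ (Fin d) × ℝ in 𝓝 z ×ˢ 𝓝[>] 0, 0 < p.2 :=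
    (eventually_mem_nhdsWithin (s := Set.Ioi (0 : ℝ)) (a := 0)).prod_inr _
  have h3 := h1.congr' (f₂ := fun p : EuclideanSpace ℝ (Fin d) × ℝ =>
      (levelValue φ p.2 ψ (ψ p.1 + (-F φ c (hessian ψ z) (∇ ψ z) + e) * p.2) p.1 - 1 / 2) / √p.2) (by
    filter_upwards [h2] with p hp
    rw [levelValue_eq_integral hp])
  -- `-F` is the speed at which the affine limit equals `-c`, and the slope in the speed is `-I`.
  convert h3 using 2
  simp only [F, hessian]
  field_simp
  ring

end Consistency

end AnisoBMO

end

/-! ### Consistency of the thresholding scheme -/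

theorem mainTheorem2 (d : ℕ) (φ : EuclideanSpace ℝ (Fin d) → ℝ)
    (hφ : AnisoBMO.IsFinslerMetric φ)
    (hdual : ContDiffOn ℝ ∞ (AnisoBMO.dualMetric φ) {0}ᶜ)
    (c : ℝ) (ψ : EuclideanSpace ℝ (Fin d) → ℝ) (hψ : ContDiff ℝ 2 ψ)
    (z : EuclideanSpace ℝ (Fin d)) (hz : ∇ ψ z ≠ 0) (ε : ℝ) (hε : 0 < ε) :
    ∃ δ : ℝ, 0 < δ ∧ ∀ x ∈ Metric.ball z δ, ∀ h ∈ Set.Ioc (0 : ℝ) δ,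
      AnisoBMO.Gminus φ c h ψ x ≤
          ((ψ x + (-AnisoBMO.F φ c (AnisoBMO.hessian ψ z) (∇ ψ z) + ε) * h : ℝ) : EReal) ∧
        ((ψ x + (-AnisoBMO.F φ c (AnisoBMO.hessian ψ z) (∇ ψ z) - ε) * h : ℝ) : EReal) ≤
          AnisoBMO.Gplus φ c h ψ x := by
  obtain ⟨I, hI, hlim⟩ := AnisoBMO.exists_tendsto_levelValue hφ hdual c hψ hz
  have hεI : 0 < ε * I := mul_pos hε hI
  -- The value `-c` is `(θ_h - 1/2) / √h`, and the two limits lie strictly on either side of it.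
  have hup := (hlim ε).eventually_lt_const (by linarith : -c - ε * I < -c)
  have hlow := (hlim (-ε)).eventually_const_lt (by linarith : -c < -c - -ε * I)
  obtain ⟨⟨r, b⟩, ⟨hr, hb⟩, hsub⟩ :=
    (Metric.nhds_basis_ball.prod (nhdsGT_basis (0 : ℝ))).mem_iff.1 (hup.and hlow)
  simp only at hr hb
  -- The filter basis gives the open interval `(0, b)`, whereas `h = δ` is allowed; hence `b / 2`.
  refine ⟨min r (b / 2), lt_min hr (by linarith), fun x hx h hh => ?_⟩
  have hh0 : 0 < h := hh.1
  obtain ⟨h1, h2⟩ := @hsub (x, h)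
    ⟨Metric.ball_subset_ball (min_le_left _ _) hx, hh0, by
      have := hh.2.trans (min_le_right r (b / 2))
      simp only
      linarith⟩
  have hs : 0 < √h := Real.sqrt_pos.2 hh0
  simp only at h1 h2
  rw [div_lt_iff₀ hs] at h1
  rw [lt_div_iff₀ hs, ← sub_eq_add_neg] at h2
  -- It suffices that one height belongs to each defining set, so no monotonicity of the level value
  -- in `s` is needed.
  refine ⟨sInf_le ⟨_, rfl, ?_⟩, le_sSup ⟨_, rfl, ?_⟩⟩ <;> unfold AnisoBMO.threshold <;> linarith
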